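/- **Theorem.** For $n\ge 0$ let $A(n)$ be the number of cubic partitions of $n$ (partitions of $n$ in which the even parts may appear in two colours) into an even number of parts minus the number of cubic partitions of $n$ into an odd number of parts, with $A(0)=1$ (equivalently, $A(n)$ is determined by $\sum_{n\ge 0}A(n)q^n=(q;q^2)_\infty(q^2;q^4)_\infty$ for $|q|<1$, where $(a;q)_\infty=\prod_{k\ge 0}(1-aq^k)$). Put $$f(a,b)=\sum_{k=-\infty}^{\infty}a^{k(k+1)/2}b^{k(k-1)/2}\quad(|ab|<1),\qquad \varphi(q)=f(q,q),\quad \psi(q)=f(q,q^3),\quad \chi(q)=(-q;q^2)_\infty,\quad f_k=(q^k;q^k)_\infty .$$ Then for every complex $q$ with $|q|<1$ the denominators below are nonzero, the series on the left converge, and $$\sum_{n=0}^{\infty}A(3n)q^n=\frac{\chi(-q)\,\psi(q^3)\,\varphi(-q^3)}{\psi(-q)\,\psi(q^2)},$$ $$\sum_{n=0}^{\infty}A(3n+1)q^n=-\frac{\psi^2(q^3)\,\chi^2(-q)}{\psi(-q)\,\psi(q^2)},$$ $$\sum_{n=0}^{\infty}A(3n+2)q^n=-\frac{\psi(-q^3)\,\psi(q^6)}{\psi^2(q^2)},$$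 $$\sum_{n=0}^{\infty}A(9n+5)q^n=-3q\,\frac{f_1f_2^4f_{12}^6}{f_4^{11}}.$$ Furthermore, for all $n\ge 0$, $$A(3n+2)\equiv -A(27n+17)\pmod 3,\qquad A(81n+44)\equiv 0\pmod 3.$$ -/

import Mathlib

/-- A cubic partition of `n`: a partition of `n` in which the even parts may appear in two colours.
It is given by the multiset `red` of parts of the first colour and the multiset `blue` of parts of
the second colour; all odd parts have the first colour. -/
@[ext]
structure CubicPartition (n : ℕ) where
  red : Multiset ℕ
  blue : Multiset ℕ
  red_pos : ∀ i ∈ red, 0 < i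
  blue_pos : ∀ i ∈ blue, 0 < i
  blue_even : ∀ i ∈ blue, Even i
  sum_eq : red.sum + blue.sum = n

/-- The number of parts of a cubic partition. -/
def CubicPartition.numParts {n : ℕ} (p : CubicPartition n) : ℕ :=
  p.red.card + p.blue.card

/-- There are only finitely many cubic partitions of `n`. -/
instance CubicPartition.instFinite (n : ℕ) : Finite (CubicPartition n) := by
  let F : CubicPartition n →
      (Σ i : Fin (n + 1), Nat.Partition i.1) × (Σ j : Fin (n + 1), Nat.Partition j.1) :=
    fun p =>
      (⟨⟨p.red.sum, by have := p.sum_eq; omega⟩, ⟨p.red, fun {i} hi => p.red_pos i hi, rfl⟩⟩,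
       ⟨⟨p.blue.sum, by have := p.sum_eq; omega⟩, ⟨p.blue, fun {i} hi => p.blue_pos i hi, rfl⟩⟩)
  refine Finite.of_injective F fun p p' h => ?_
  have h1 := congrArg (fun x => x.1.2.parts) h
  have h2 := congrArg (fun x => x.2.2.parts) h
  exact CubicPartition.ext h1 h2

/-- The number of cubic partitions of `n` into an even number of parts. -/
noncomputable def cubicEven (n : ℕ) : ℕ :=
  Nat.card {p : CubicPartition n // Even p.numParts}

/-- The number of cubic partitions of `n` into an odd number of parts. -/
noncomputable def cubicOdd (n : ℕ) : ℕ :=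
  Nat.card {p : CubicPartition n // Odd p.numParts}

/-- `A(n)`: the number of cubic partitions of `n` into an even number of parts minus the number of
those into an odd number of parts. -/
noncomputable def cubicA (n : ℕ) : ℤ :=
  (cubicEven n : ℤ) - (cubicOdd n : ℤ)

/-- `(a; q)_∞`, used for `‖q‖ < 1`, where the product converges. -/
noncomputable def qPochInf (a q : ℂ) : ℂ :=
  ∏' k : ℕ, (1 - a * q ^ k)

/-- Ramanujan's general theta function `f(a, b)`, used for `‖a * b‖ < 1`, where the bilateral
series converges. The integer exponents are nonnegative and the divisions by 2 are exact. -/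
noncomputable def ramanujanTheta (a b : ℂ) : ℂ :=
  ∑' k : ℤ, a ^ (k * (k + 1) / 2) * b ^ (k * (k - 1) / 2)

/-- `φ(q) = f(q, q)`. -/
noncomputable def thetaPhi (q : ℂ) : ℂ := ramanujanTheta q q

/-- `ψ(q) = f(q, q³)`. -/
noncomputable def thetaPsi (q : ℂ) : ℂ := ramanujanTheta q (q ^ 3)

/-- `χ(q) = (-q; q²)_∞`. -/
noncomputable def thetaChi (q : ℂ) : ℂ := qPochInf (-q) (q ^ 2)

/-- `f_k = (q^k; q^k)_∞`. -/
noncomputable def eulerF (k : ℕ) (q : ℂ) : ℂ := qPochInf (q ^ k) (q ^ k)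

/-!
# A 3-dissection of the cubic partition function weighted by parity

Counting cubic partitions with the sign `(-1)^{number of parts}` gives the generating function
`f₁ / f₄ = ψ(-q) / ψ(q²)`, and the four series in the theorem are read off from a 3-dissection of
this quotient, that is, from writing it as `F₀(q³) + q F₁(q³) + q² F₂(q³)`.

* The series `ψ(q)` itself splits as `S(q³) + q ψ(q⁹)` with `S(q) = f(q, q²)`
  (`thetaPsi_dissection`): its terms are sorted by the residue of the index modulo 3.
* The denominator is rationalised by the sum of two cubes. Multiplying the previous identity over
  the three cube roots of unity gives `S(q)³ + q ψ(q³)³ = ψ(q)⁴ / ψ(q³)` (`thetaPent_cube_add`), so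
  that `1 / ψ(q)` is a polynomial in `q`, with coefficients in functions of `q³` (`inv_thetaPsi`).
* The components so obtained are sums of two eta quotients. They collapse to the products in the
  theorem by one identity of level 12, `eulerE_level_twelve`, and its image under `q ↦ -q`. That
  identity is an instance of Weierstrass' three-term relation: a product `θ(xy) θ(x/y)` of theta
  functions in base `Q` is an alternating form in `x` and `y` of rank two
  (`modTheta_mul_modTheta`), and such forms satisfy the Plücker relation. The theta functions are
  turned into products by the Jacobi triple product (`hasSum_tripleProduct`), proved here as a limit
  of the finite `q`-binomial theorem.

Squaring the rationalised reciprocal of `ψ(q²)` dissects `∑ A(3n+2) q^n` once more, and the middle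
component has the single term with factor 3 that gives `∑ A(9n+5) q^n`.

All functions in a dissection are analytic on the unit disc, so they have Taylor series converging
there, and the uniqueness of Taylor coefficients identifies the components with the sums over
residue classes (`Represents.trisection`). The same principle carries identities between functions
back to identities between power series with integer coefficients, which is how the congruences
arise. Modulo 3 the Frobenius map turns `ψ(X²)³` into `ψ(X⁶)`, so that
`∑ A(3n+2) X^n ≡ -ψ(-X³) ψ(X²)`, and dissecting the right-hand side twice by
`ψ(X) = S(X³) + X ψ(X⁹)` reproduces it up to sign (`exists_dissection_mod_three`).
-/

open Filter Topology

/-! ### Infinite products -/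

lemma summable_norm_mul_pow (a : ℂ) {q : ℂ} (hq : ‖q‖ < 1) :
    Summable fun k : ℕ => ‖-(a * q ^ k)‖ := by
  simpa using (summable_geometric_of_lt_one (norm_nonneg _) hq).mul_left ‖a‖

lemma multipliable_qPochInf (a : ℂ) {q : ℂ} (hq : ‖q‖ < 1) :
    Multipliable fun k : ℕ => 1 - a * q ^ k := by
  simpa [sub_eq_add_neg] using multipliable_one_add_of_summable (summable_norm_mul_pow a hq)

lemma qPochInf_ne_zero {a q : ℂ} (hq : ‖q‖ < 1) (ha : ‖a‖ < 1) : qPochInf a q ≠ 0 := by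
  have h : ∀ k : ℕ, 1 + -(a * q ^ k) ≠ 0 := fun k h => by
    have h1 : ‖a * q ^ k‖ < 1 := by
      rw [norm_mul, norm_pow]
      exact mul_lt_one_of_nonneg_of_lt_one_left (norm_nonneg _) ha
        (pow_le_one₀ (norm_nonneg _) hq.le)
    have h2 : a * q ^ k = 1 := by linear_combination -h
    simp [h2] at h1
  simpa [qPochInf, sub_eq_add_neg] using tprod_one_add_ne_zero_of_summable h
    (summable_norm_mul_pow a hq)

/-- The product `(a; q)_∞ (-a; q)_∞` merges into one product in base `q²`. -/
lemma qPochInf_mul_neg (a : ℂ) {q : ℂ} (hq : ‖q‖ < 1) :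
    qPochInf a q * qPochInf (-a) q = qPochInf (a ^ 2) (q ^ 2) := by
  rw [qPochInf, qPochInf, qPochInf, ← (multipliable_qPochInf a hq).tprod_mul
    (multipliable_qPochInf (-a) hq)]
  exact tprod_congr fun k => by ring

/-- The cubic analogue of `qPochInf_mul_neg`, for a primitive cube root of unity `w`. -/
lemma qPochInf_mul_cube {w : ℂ} (hw : w ^ 2 + w + 1 = 0) (a : ℂ) {q : ℂ} (hq : ‖q‖ < 1) :
    qPochInf a q * qPochInf (w * a) q * qPochInf (w ^ 2 * a) q = qPochInf (a ^ 3) (q ^ 3) := by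
  have h3 : w ^ 3 = 1 := by linear_combination (w - 1) * hw
  rw [qPochInf, qPochInf, qPochInf, qPochInf, ← (multipliable_qPochInf a hq).tprod_mul
    (multipliable_qPochInf _ hq), ← ((multipliable_qPochInf a hq).mul
    (multipliable_qPochInf _ hq)).tprod_mul (multipliable_qPochInf _ hq)]
  refine tprod_congr fun k => ?_
  rw [← pow_mul, mul_comm 3 k, pow_mul]
  generalize q ^ k = x
  linear_combination (-(a * x) + (a * x) ^ 2 * w) * hw - (a * x) ^ 3 * h3

lemma qPochInf_split_two (a : ℂ) {q : ℂ} (hq : ‖q‖ < 1) :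
    qPochInf a q = qPochInf a (q ^ 2) * qPochInf (a * q) (q ^ 2) := by
  have hq2 : ‖q ^ 2‖ < 1 := by rw [norm_pow]; exact pow_lt_one₀ (norm_nonneg _) hq two_ne_zero
  have h0 := multipliable_qPochInf a hq2
  have h1 := multipliable_qPochInf (a * q) hq2
  rw [qPochInf, qPochInf, qPochInf, ← tprod_even_mul_odd (f := fun k : ℕ => 1 - a * q ^ k)]
  · congr 1
    · exact tprod_congr fun k => by rw [pow_mul]
    · exact tprod_congr fun k => by ring
  · exact h0.congr fun k => by rw [pow_mul]
  · exact h1.congr fun k => by ring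

lemma qPochInf_split_three (a : ℂ) {q : ℂ} (hq : ‖q‖ < 1) :
    qPochInf a q =
      qPochInf a (q ^ 3) * qPochInf (a * q) (q ^ 3) * qPochInf (a * q ^ 2) (q ^ 3) := by
  have hq3 : ‖q ^ 3‖ < 1 := by rw [norm_pow]; exact pow_lt_one₀ (norm_nonneg _) hq three_ne_zero
  have hm : HasProd (fun p : Fin 3 × ℕ => 1 - a * q ^ (p.1 + 3 * p.2 : ℕ)) (qPochInf a q) := by
    have h := (multipliable_qPochInf a hq).hasProd
    rw [← (Nat.divModEquiv 3).symm.hasProd_iff, ← (Equiv.prodComm _ _).hasProd_iff] at h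
    rw [qPochInf]
    convert h using 3 with p
    simp [Nat.divModEquiv, mul_comm, add_comm]
  have hf : ∀ r : Fin 3, HasProd (fun k : ℕ => 1 - a * q ^ ((r : ℕ) + 3 * k))
      (qPochInf (a * q ^ (r : ℕ)) (q ^ 3)) := fun r => by
    rw [qPochInf]
    convert (multipliable_qPochInf (a * q ^ (r : ℕ)) hq3).hasProd using 2 with k
    ring
  have := (hm.prod_fiberwise hf).unique (hasProd_fintype _)
  rw [this, Fin.prod_univ_three]
  simp

/-! ### The Jacobi triple product -/

/-- The finite product `(q; q)_n`. -/
noncomputable def qFactorial (q : ℂ) (n : ℕ) : ℂ := ∏ i ∈ Finset.range n, (1 - q ^ (i + 1))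

/-- The reciprocal of `(q; q)_n`, extended by `0` to negative `n`. With this convention
`qFactorialInv_sub_one` holds for every integer, so that Pascal's rule for Gaussian binomial
coefficients needs no boundary cases. -/
noncomputable def qFactorialInv (q : ℂ) (n : ℤ) : ℂ :=
  if n < 0 then 0 else (qFactorial q n.toNat)⁻¹

lemma one_sub_pow_ne_zero {q : ℂ} (hq : ‖q‖ < 1) (n : ℕ) : 1 - q ^ (n + 1) ≠ 0 := fun h => by
  have h1 : ‖q ^ (n + 1)‖ < 1 := by
    rw [norm_pow]; exact pow_lt_one₀ (norm_nonneg _) hq n.succ_ne_zero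
  rw [← sub_eq_zero.1 h] at h1
  simp at h1

lemma qFactorialInv_sub_one {q : ℂ} (hq : ‖q‖ < 1) (n : ℤ) :
    qFactorialInv q (n - 1) = (1 - q ^ n) * qFactorialInv q n := by
  rcases lt_trichotomy n 0 with h | rfl | h
  · simp [qFactorialInv, h, show n - 1 < 0 by omega]
  · simp [qFactorialInv]
  · obtain ⟨m, rfl⟩ : ∃ m : ℕ, n = m + 1 := ⟨(n - 1).toNat, by omega⟩
    have hm : ¬ ((m : ℤ) + 1 < 0) := by omega
    have h1 : ((m : ℤ) + 1).toNat = m + 1 := by omega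
    have := one_sub_pow_ne_zero hq m
    rw [qFactorialInv, qFactorialInv, add_sub_cancel_right, if_neg (by omega), if_neg hm, h1,
      Int.toNat_natCast, qFactorial, qFactorial, Finset.prod_range_succ, mul_inv]
    rw [show q ^ ((m : ℤ) + 1) = q ^ (m + 1) by exact_mod_cast zpow_natCast q (m + 1)]
    field_simp

lemma zpow_choose_succ {q : ℂ} (hq0 : q ≠ 0) (k : ℤ) :
    q ^ ((k + 1) * k / 2) = q ^ (k * (k - 1) / 2) * q ^ k := by
  rw [← zpow_add₀ hq0]
  congr 1
  rw [show (k + 1) * k = k * (k - 1) + k * 2 by ring, Int.add_mul_ediv_right _ _ two_ne_zero]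

/-- The finite form of the Jacobi triple product, which is the `q`-binomial theorem. -/
lemma hasSum_finite_tripleProduct {q w : ℂ} (hq : ‖q‖ < 1) (hq0 : q ≠ 0) (hw : w ≠ 0) (M L : ℕ) :
    HasSum (fun k : ℤ => qFactorial q (M + L) * qFactorialInv q (M - k) * qFactorialInv q (L + k) *
      (q ^ (k * (k - 1) / 2) * w ^ k))
      ((∏ i ∈ Finset.range M, (1 + w * q ^ i)) * ∏ i ∈ Finset.range L, (1 + q / w * q ^ i)) := by
  induction M with
  | zero =>
    induction L with
    | zero =>
      have := hasSum_single (f := fun k : ℤ => qFactorial q (0 + 0) *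
        qFactorialInv q ((0 : ℕ) - k) * qFactorialInv q ((0 : ℕ) + k) *
        (q ^ (k * (k - 1) / 2) * w ^ k)) 0 (fun k hk => by
          rcases lt_or_gt_of_ne hk with h | h
          · simp [qFactorialInv, h]
          · simp [qFactorialInv, h])
      simpa [qFactorial, qFactorialInv] using this
    | succ L ih =>
      have h2 := (((Equiv.addRight (1 : ℤ)).hasSum_iff.2 ih).mul_left (q ^ (L + 1) / w))
      have h := ih.add h2
      rw [Finset.prod_range_succ _ L]
      convert h using 1
      · funext k
        have e1 : ((0 : ℕ) : ℤ) - (k + 1) = ((0 : ℕ) : ℤ) - k - 1 := by ring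
        have e2 : (L : ℤ) + k = ((L + 1 : ℕ) : ℤ) + k - 1 := by push_cast; ring
        have e3 : (L : ℤ) + (k + 1) = ((L + 1 : ℕ) : ℤ) + k := by push_cast; ring
        have e4 : qFactorial q (0 + (L + 1)) = qFactorial q (0 + L) * (1 - q ^ (L + 1)) := by
          rw [zero_add, zero_add, qFactorial, Finset.prod_range_succ, qFactorial]
        simp only [Function.comp, Equiv.coe_addRight, e1, e3]
        rw [e2, qFactorialInv_sub_one hq, qFactorialInv_sub_one hq, e4, add_sub_cancel_right,
          zpow_choose_succ hq0, zpow_add_one₀ hw, sub_eq_add_neg ((0 : ℕ) : ℤ) k, zpow_add₀ hq0,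
          zpow_add₀ hq0, zpow_natCast, zpow_natCast, zpow_neg]
        have := zpow_ne_zero k hq0
        field_simp
        ring
      · ring
  | succ M ih =>
    have h2 := (((Equiv.subRight (1 : ℤ)).hasSum_iff.2 ih).mul_left (w * q ^ M))
    have h := ih.add h2
    rw [Finset.prod_range_succ _ M]
    convert h using 1
    · funext k
      have e1 : (M : ℤ) - k = ((M + 1 : ℕ) : ℤ) - k - 1 := by push_cast; ring
      have e2 : (L : ℤ) + (k - 1) = L + k - 1 := by ring
      have e3 : (M : ℤ) - (k - 1) = ((M + 1 : ℕ) : ℤ) - k := by push_cast; ring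
      have e4 : qFactorial q (M + 1 + L) = qFactorial q (M + L) * (1 - q ^ (M + L + 1)) := by
        rw [show M + 1 + L = M + L + 1 by ring, qFactorial, Finset.prod_range_succ, qFactorial]
      have e5 := zpow_choose_succ hq0 (k - 1)
      rw [sub_add_cancel] at e5
      simp only [Function.comp, Equiv.subRight_apply, e2, e3]
      rw [e1, qFactorialInv_sub_one hq, qFactorialInv_sub_one hq, e4, e5, zpow_sub_one₀ hw,
        zpow_sub_one₀ hq0, sub_eq_add_neg ((M + 1 : ℕ) : ℤ) k, zpow_add₀ hq0, zpow_add₀ hq0,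
        zpow_natCast, zpow_natCast, zpow_neg]
      have := zpow_ne_zero k hq0
      field_simp
      ring
    · ring

/-- Gaussian decay: the bilateral theta series converges absolutely. -/
lemma summable_norm_theta {q w : ℂ} (hq : ‖q‖ < 1) (hq0 : q ≠ 0) (hw : w ≠ 0) :
    Summable fun k : ℤ => ‖q ^ (k * (k - 1) / 2) * w ^ k‖ := by
  have key : ∀ v : ℂ, v ≠ 0 → Summable fun k : ℕ =>
      ‖q ^ ((k : ℤ) * (k - 1) / 2) * v ^ (k : ℤ)‖ := fun v hv => by
    refine (summable_of_ratio_test_tendsto_lt_one (l := 0) one_pos (.of_forall fun k => ?_) ?_)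
    · exact norm_ne_zero_iff.2 (mul_ne_zero (zpow_ne_zero _ hq0) (zpow_ne_zero _ hv))
    · have : Tendsto (fun k : ℕ => ‖q‖ ^ k * ‖v‖) atTop (𝓝 (0 * ‖v‖)) :=
        (tendsto_pow_atTop_nhds_zero_of_lt_one (norm_nonneg _) hq).mul_const _
      rw [zero_mul] at this
      refine this.congr fun k => ?_
      have h1 := zpow_choose_succ hq0 (k : ℤ)
      have h2 : q ^ ((k : ℤ) * (k - 1) / 2) ≠ 0 := zpow_ne_zero _ hq0
      push_cast
      rw [add_sub_cancel_right, h1, zpow_add_one₀ hv, norm_norm, norm_norm, ← norm_div,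
        ← norm_pow, ← norm_mul]
      congr 1
      have h3 : v ^ (k : ℤ) ≠ 0 := zpow_ne_zero _ hv
      rw [zpow_natCast q k]
      field_simp
  refine Summable.of_nat_of_neg (key w hw) ?_
  refine (key (q / w) (div_ne_zero hq0 hw)).congr fun k => ?_
  congr 1
  have h1 := zpow_choose_succ hq0 (k : ℤ)
  rw [show (-(k : ℤ)) * (-k - 1) = (k + 1) * k by ring, h1, div_zpow, zpow_neg]
  field_simp

lemma tendsto_prod_qPochInf (a : ℂ) {q : ℂ} (hq : ‖q‖ < 1) :
    Tendsto (fun n => ∏ i ∈ Finset.range n, (1 - a * q ^ i)) atTop (𝓝 (qPochInf a q)) :=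
  (multipliable_qPochInf a hq).hasProd.tendsto_prod_nat

lemma tendsto_qFactorial {q : ℂ} (hq : ‖q‖ < 1) :
    Tendsto (qFactorial q) atTop (𝓝 (qPochInf q q)) := by
  exact (tendsto_prod_qPochInf q hq).congr
    fun n => (show _ = qFactorial q n by simp [qFactorial, pow_succ'])

lemma tendsto_qFactorialInv {q : ℂ} (hq : ‖q‖ < 1) :
    Tendsto (qFactorialInv q) atTop (𝓝 (qPochInf q q)⁻¹) := by
  have h := ((tendsto_qFactorial hq).inv₀ (qPochInf_ne_zero hq hq)).comp 
    (tendsto_atTop_atTop.2 fun b => ⟨(b : ℤ), fun n hn => by omega⟩ : Tendsto Int.toNat atTop atTop)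
  refine h.congr' ?_
  filter_upwards [eventually_ge_atTop 0] with n hn
  simp [qFactorialInv, not_lt.2 hn]

lemma exists_norm_qFactorialInv_le {q : ℂ} (hq : ‖q‖ < 1) :
    ∃ C, ∀ n : ℤ, ‖qFactorialInv q n‖ ≤ C := by
  have h := (tendsto_qFactorial hq).inv₀ (qPochInf_ne_zero hq hq)
  obtain ⟨C, hC⟩ := (Metric.isBounded_range_of_tendsto _ h).exists_norm_le
  refine ⟨C, fun n => ?_⟩
  have h0 : 0 ≤ C := (norm_nonneg _).trans (hC _ ⟨0, rfl⟩)
  rw [qFactorialInv]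
  split_ifs
  · simpa
  · exact hC _ ⟨n.toNat, rfl⟩

/-- The **Jacobi triple product identity**, as the limit of `hasSum_finite_tripleProduct` by
dominated convergence. -/
theorem hasSum_tripleProduct {q w : ℂ} (hq : ‖q‖ < 1) (hq0 : q ≠ 0) (hw : w ≠ 0) :
    HasSum (fun k : ℤ => q ^ (k * (k - 1) / 2) * w ^ k)
      (qPochInf (-w) q * qPochInf (-(q / w)) q * qPochInf q q) := by
  have hne := qPochInf_ne_zero hq hq
  obtain ⟨C, hC⟩ := exists_norm_qFactorialInv_le hq
  obtain ⟨D, hD⟩ := (Metric.isBounded_range_of_tendsto _ (tendsto_qFactorial hq)).exists_norm_le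
  have hs := summable_norm_theta hq hq0 hw
  have hlim := tendsto_tsum_of_dominated_convergence (𝓕 := atTop)
    (f := fun (N : ℕ) (k : ℤ) => qFactorial q (N + N) * qFactorialInv q (N - k) *
      qFactorialInv q (N + k) * (q ^ (k * (k - 1) / 2) * w ^ k))
    (g := fun k => qPochInf q q * (qPochInf q q)⁻¹ * (qPochInf q q)⁻¹ *
      (q ^ (k * (k - 1) / 2) * w ^ k))
    (hs.mul_left (D * C * C)) (fun k => ?_) (.of_forall fun N k => ?_)
  · have hfin : Tendsto (fun N : ℕ => (∏ i ∈ Finset.range N, (1 + w * q ^ i)) *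
        ∏ i ∈ Finset.range N, (1 + q / w * q ^ i)) atTop
        (𝓝 (qPochInf (-w) q * qPochInf (-(q / w)) q)) := by
      simpa using (tendsto_prod_qPochInf (-w) hq).mul (tendsto_prod_qPochInf (-(q / w)) hq)
    have h1 := tendsto_nhds_unique hlim
      (hfin.congr fun N => (hasSum_finite_tripleProduct hq hq0 hw N N).tsum_eq.symm)
    rw [tsum_mul_left, mul_inv_cancel₀ hne, one_mul] at h1
    rw [← h1, mul_right_comm, inv_mul_cancel₀ hne, one_mul]
    exact hs.of_norm.hasSum
  · refine Tendsto.mul_const _ ((Tendsto.mul ?_ ?_).mul ?_)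
    · exact (tendsto_qFactorial hq).comp
        (tendsto_atTop_mono (fun n => Nat.le_add_left n n) tendsto_id)
    · refine (tendsto_qFactorialInv hq).comp ?_
      simpa [sub_eq_add_neg] using
        tendsto_atTop_add_const_right atTop (-k) tendsto_natCast_atTop_atTop
    · exact (tendsto_qFactorialInv hq).comp
        (tendsto_atTop_add_const_right atTop k tendsto_natCast_atTop_atTop)
  · rw [norm_mul, norm_mul, norm_mul]
    have hC0 := (norm_nonneg _).trans (hC 0)
    have hD0 := (norm_nonneg _).trans (hD _ ⟨0, rfl⟩)
    gcongr
    · exact hD _ ⟨_, rfl⟩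
    · exact hC _
    · exact hC _

/-! ### Power series converging on the unit disc -/

/-- The formal power series `g` converges to the function `F` on the open unit disc. -/
def Represents (g : PowerSeries ℂ) (F : ℂ → ℂ) : Prop :=
  ∀ q : ℂ, ‖q‖ < 1 → HasSum (fun n : ℕ => PowerSeries.coeff n g * q ^ n) (F q)

/-- The coefficients of `g₀(X³) + X g₁(X³) + X² g₂(X³)` along `3n + r` are those of `g_r`. -/
lemma PowerSeries.coeff_trisection {R : Type*} [CommRing R] (g : Fin 3 → PowerSeries R) (r : Fin 3)
    (n : ℕ) : coeff (3 * n + (r : ℕ)) ((g 0).expand 3 three_ne_zero +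
      X ^ 1 * (g 1).expand 3 three_ne_zero + X ^ 2 * (g 2).expand 3 three_ne_zero) =
      coeff n (g r) := by
  have key : ∀ (s : ℕ) (hs : s < 3) (f : PowerSeries R), coeff (3 * n + (r : ℕ))
      (X ^ s * f.expand 3 three_ne_zero) = if (r : ℕ) = s then coeff n f else 0 := by
    intro s hs f
    have hr := r.2
    rw [coeff_X_pow_mul', coeff_expand]
    split_ifs with h1 h2 h3 h3 h3
    · congr 2; omega
    · omega
    · omega
    · rfl
    · omega
    · rfl
  have key0 := key 0 (by omega) (g 0)
  rw [pow_zero, one_mul] at key0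
  rw [map_add, map_add, key0, key 1 (by omega), key 2 (by omega)]
  fin_cases r <;> simp

namespace Represents

open PowerSeries

variable {g h : PowerSeries ℂ} {F G : ℂ → ℂ}

lemma congr (hg : Represents g F) (hFG : ∀ q : ℂ, ‖q‖ < 1 → F q = G q) : Represents g G :=
  fun q hq => hFG q hq ▸ hg q hq

lemma hasFPowerSeriesOnBall (hg : Represents g F) :
    HasFPowerSeriesOnBall F (FormalMultilinearSeries.ofScalars ℂ fun n => coeff n g) 0 1 := by
  refine HasFPowerSeriesOnBall.mk ?_ one_pos fun {y} hy => ?_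
  · refine ENNReal.le_of_forall_nnreal_lt fun r hr => ?_
    have hr1 : ‖((r : ℝ) : ℂ)‖ < 1 := by
      simpa [← NNReal.coe_lt_one] using hr
    refine FormalMultilinearSeries.le_radius_of_tendsto _ (l := 0) ?_
    have := (hg _ hr1).summable.tendsto_atTop_zero.norm
    simpa [FormalMultilinearSeries.ofScalars_norm] using this
  · have hy1 : ‖y‖ < 1 := by simpa [← ofReal_norm] using hy
    simpa [FormalMultilinearSeries.ofScalars, mul_comm] using hg y hy1

lemma unique (hg : Represents g F) (hh : Represents h F) : g = h := by
  have := hg.hasFPowerSeriesOnBall.hasFPowerSeriesAt.eq_formalMultilinearSeries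
    hh.hasFPowerSeriesOnBall.hasFPowerSeriesAt
  ext n
  exact congrFun ((FormalMultilinearSeries.ofScalars_series_injective ℂ ℂ) this) n

lemma exists_of_differentiableOn (hF : DifferentiableOn ℂ F (Metric.ball 0 1)) :
    ∃ g, Represents g F := by
  have h1 : ∀ r : NNReal, 0 < r → r < 1 → HasFPowerSeriesOnBall F (cauchyPowerSeries F 0 r) 0 r :=
    fun r h0 h1 => (hF.mono (Metric.closedBall_subset_ball (by exact_mod_cast h1))
      ).hasFPowerSeriesOnBall h0
  have hhalf := h1 (1 / 2) (by norm_num) (by rw [← NNReal.coe_lt_coe]; norm_num)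
  refine ⟨mk fun n => (cauchyPowerSeries F 0 (1 / 2 : NNReal)).coeff n, fun q hq => ?_⟩
  obtain ⟨r, hqr, hr1⟩ := exists_between hq
  lift r to NNReal using (norm_nonneg q).trans hqr.le
  have hr0 : 0 < r := by exact_mod_cast (norm_nonneg q).trans_lt hqr
  have h2 := h1 r hr0 (by exact_mod_cast hr1)
  rw [hhalf.hasFPowerSeriesAt.eq_formalMultilinearSeries h2.hasFPowerSeriesAt]
  have := h2.hasSum (y := q) (by simpa [← ofReal_norm] using hqr)
  simpa [mul_comm] using this

lemma add (hg : Represents g F) (hh : Represents h G) :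
    Represents (g + h) fun q => F q + G q := fun q hq => by
  simpa [add_mul] using (hg q hq).add (hh q hq)

lemma summable_norm (hg : Represents g F) {q : ℂ} (hq : ‖q‖ < 1) :
    Summable fun n : ℕ => ‖coeff n g * q ^ n‖ := (hg q hq).summable.norm

lemma mul (hg : Represents g F) (hh : Represents h G) :
    Represents (g * h) fun q => F q * G q := fun q hq => by
  have h1 := tsum_mul_tsum_eq_tsum_sum_antidiagonal_of_summable_norm
    (hg.summable_norm hq) (hh.summable_norm hq)
  have h2 := (summable_norm_sum_mul_antidiagonal_of_summable_norm
    (hg.summable_norm hq) (hh.summable_norm hq)).of_norm.hasSum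
  rw [← h1, (hg q hq).tsum_eq, (hh q hq).tsum_eq] at h2
  refine h2.congr_fun fun n => ?_
  rw [coeff_mul, Finset.sum_mul]
  refine Finset.sum_congr rfl fun p hp => ?_
  rw [← Finset.HasAntidiagonal.mem_antidiagonal.1 hp, pow_add]
  ring

lemma X_pow (k : ℕ) : Represents (X ^ k) fun q => q ^ k := fun q _ => by
  have := hasSum_single (f := fun n : ℕ => coeff n (X ^ k : PowerSeries ℂ) * q ^ n) k
    fun n hn => by simp [coeff_X_pow, hn]
  simpa [coeff_X_pow] using this

lemma C (c : ℂ) : Represents (PowerSeries.C c) fun _ => c := fun q _ => by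
  have := hasSum_single (f := fun n : ℕ => coeff n (PowerSeries.C c) * q ^ n) 0
    fun n hn => by simp [coeff_C, hn]
  simpa [coeff_C] using this

lemma expand (hg : Represents g F) (k : ℕ) (hk : k ≠ 0) :
    Represents (g.expand k hk) fun q => F (q ^ k) := fun q hq => by
  have h1 := hg (q ^ k) (by rw [norm_pow]; exact pow_lt_one₀ (norm_nonneg _) hq hk)
  have hinj : Function.Injective fun n : ℕ => k * n := fun a b h =>
    Nat.eq_of_mul_eq_mul_left (Nat.pos_of_ne_zero hk) h
  refine (hinj.hasSum_iff fun n hn => ?_).1 (h1.congr_fun fun n => ?_)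
  · rw [coeff_expand_of_not_dvd, zero_mul]
    rintro ⟨m, rfl⟩
    exact hn ⟨m, rfl⟩
  · simp [coeff_expand_mul, pow_mul]

/-- If `F(q) = F₀(q³) + q F₁(q³) + q² F₂(q³)` with analytic `F_r`, then the coefficients of `F`
along `3n + r` are the Taylor coefficients of `F_r`. -/
lemma trisection (hg : Represents g F) {H : Fin 3 → ℂ → ℂ}
    (hH : ∀ r, DifferentiableOn ℂ (H r) (Metric.ball 0 1))
    (hF : ∀ q : ℂ, ‖q‖ < 1 → F q = H 0 (q ^ 3) + q * H 1 (q ^ 3) + q ^ 2 * H 2 (q ^ 3))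
    (r : Fin 3) {q : ℂ} (hq : ‖q‖ < 1) :
    HasSum (fun n : ℕ => coeff (3 * n + r) g * q ^ n) (H r q) := by
  choose k hk using fun r => exists_of_differentiableOn (hH r)
  -- Taylor coefficients are unique, so `g` is the trisected series of the `H r`
  have hrep := (((hk 0).expand 3 three_ne_zero).add
    ((X_pow 1).mul ((hk 1).expand 3 three_ne_zero))).add
    ((X_pow 2).mul ((hk 2).expand 3 three_ne_zero))
  rw [hg.unique (hrep.congr fun q hq => by rw [hF q hq, pow_one])]
  exact ((hk r) q hq).congr_fun fun n => by rw [coeff_trisection k]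

end Represents

/-! ### Product formulas for theta functions -/

/-- Euler's product `(q; q)_∞`. -/
noncomputable def eulerE (q : ℂ) : ℂ := qPochInf q q

lemma eulerF_eq (k : ℕ) (q : ℂ) : eulerF k q = eulerE (q ^ k) := rfl

lemma norm_pow_lt_one {q : ℂ} (hq : ‖q‖ < 1) {k : ℕ} (hk : k ≠ 0) : ‖q ^ k‖ < 1 := by
  rw [norm_pow]; exact pow_lt_one₀ (norm_nonneg _) hq hk

lemma eulerE_ne_zero {q : ℂ} (hq : ‖q‖ < 1) : eulerE q ≠ 0 := qPochInf_ne_zero hq hq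

lemma eulerE_pow_ne_zero {q : ℂ} (hq : ‖q‖ < 1) {k : ℕ} (hk : k ≠ 0) : eulerE (q ^ k) ≠ 0 :=
  eulerE_ne_zero (norm_pow_lt_one hq hk)

lemma eulerE_zero : eulerE 0 = 1 := by simp [eulerE, qPochInf]

lemma differentiableOn_eulerE : DifferentiableOn ℂ eulerE (Metric.ball 0 1) :=
  ModularForm.differentiableOn_tprod_one_sub_pow.congr fun q _ =>
    tprod_congr fun n => by rw [pow_succ']

/-- `(q; q²)_∞ = (q; q)_∞ / (q²; q²)_∞`. -/
lemma qPochInf_odd {q : ℂ} (hq : ‖q‖ < 1) : qPochInf q (q ^ 2) * eulerE (q ^ 2) = eulerE q := by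
  rw [eulerE, eulerE, qPochInf_split_two q hq, pow_two]

lemma qPochInf_neg_odd {q : ℂ} (hq : ‖q‖ < 1) :
    qPochInf (-q) (q ^ 2) * (eulerE q * eulerE (q ^ 4)) = eulerE (q ^ 2) ^ 2 := by
  have hq2 := norm_pow_lt_one hq two_ne_zero
  have h1 := qPochInf_mul_neg q hq2
  have h2 := qPochInf_odd hq
  have h3 := qPochInf_odd hq2
  rw [← pow_mul, show 2 * 2 = 4 from rfl] at h1 h3
  rw [← h2, ← h3, ← h1]
  ring

/-- The substitution `q ↦ -q` in Euler's product. -/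
lemma eulerE_neg {q : ℂ} (hq : ‖q‖ < 1) :
    eulerE (-q) * (eulerE q * eulerE (q ^ 4)) = eulerE (q ^ 2) ^ 3 := by
  have h1 := qPochInf_odd (q := -q) (by rwa [norm_neg])
  rw [neg_sq] at h1
  rw [← h1, mul_right_comm, qPochInf_neg_odd hq, ← pow_succ]

/-- The product over the conjugates of `q` under multiplication by cube roots of unity. -/
lemma eulerE_mul_cube {w : ℂ} (hw : w ^ 2 + w + 1 = 0) {q : ℂ} (hq : ‖q‖ < 1) :
    eulerE q * eulerE (w * q) * eulerE (w ^ 2 * q) * eulerE (q ^ 9) = eulerE (q ^ 3) ^ 4 := by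
  have h3 : w ^ 3 = 1 := by linear_combination (w - 1) * hw
  have hn : ‖w‖ = 1 := by
    have : ‖w‖ ^ 3 = 1 := by rw [← norm_pow, h3, norm_one]
    exact (pow_eq_one_iff_of_nonneg (norm_nonneg _) three_ne_zero).1 this
  have hq3 := norm_pow_lt_one hq three_ne_zero
  have hw1 : ‖w * q‖ < 1 := by rwa [norm_mul, hn, one_mul]
  have hw2 : ‖w ^ 2 * q‖ < 1 := by rwa [norm_mul, norm_pow, hn, one_pow, one_mul]
  have e1 : (w * q) ^ 3 = q ^ 3 := by linear_combination q ^ 3 * h3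
  have e2 : (w ^ 2 * q) ^ 3 = q ^ 3 := by linear_combination q ^ 3 * (w ^ 3 + 1) * h3
  have split : ∀ x : ℂ, ‖x‖ < 1 → eulerE x =
      qPochInf x (x ^ 3) * qPochInf (x ^ 2) (x ^ 3) * eulerE (x ^ 3) := fun x hx => by
    rw [eulerE, eulerE, qPochInf_split_three x hx]
    ring_nf
  have c1 := qPochInf_mul_cube hw q hq3
  have c2 := qPochInf_mul_cube hw (q ^ 2) hq3
  have s3 := split _ hq3
  rw [split q hq, split _ hw1, split _ hw2, e1, e2]
  have f1 : (w * q) ^ 2 = w ^ 2 * q ^ 2 := by ring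
  have f2 : (w ^ 2 * q) ^ 2 = w * q ^ 2 := by linear_combination w * q ^ 2 * h3
  rw [f1, f2]
  simp only [← pow_mul] at c1 c2 s3
  norm_num at c1 c2 s3
  linear_combination (qPochInf (q ^ 2) (q ^ 3) * qPochInf (w * q ^ 2) (q ^ 3) *
    qPochInf (w ^ 2 * q ^ 2) (q ^ 3) * eulerE (q ^ 3) ^ 3 * eulerE (q ^ 9)) * c1 +
    qPochInf (q ^ 3) (q ^ 9) * eulerE (q ^ 3) ^ 3 * eulerE (q ^ 9) * c2 - eulerE (q ^ 3) ^ 3 * s3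

lemma ramanujanTheta_term {a : ℂ} (ha : a ≠ 0) (b : ℂ) (k : ℤ) :
    (a * b) ^ (k * (k - 1) / 2) * a ^ k = a ^ (k * (k + 1) / 2) * b ^ (k * (k - 1) / 2) := by
  rw [mul_zpow, mul_right_comm, ← zpow_add₀ ha]
  congr 2
  rw [show k * (k + 1) = k * (k - 1) + k * 2 by ring, Int.add_mul_ediv_right _ _ two_ne_zero]

/-- The Jacobi triple product in Ramanujan's notation. -/
lemma hasSum_ramanujanTheta {a b : ℂ} (ha : a ≠ 0) (hb : b ≠ 0) (hab : ‖a * b‖ < 1) :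
    HasSum (fun k : ℤ => a ^ (k * (k + 1) / 2) * b ^ (k * (k - 1) / 2))
      (qPochInf (-a) (a * b) * qPochInf (-b) (a * b) * eulerE (a * b)) := by
  have h := hasSum_tripleProduct hab (mul_ne_zero ha hb) ha
  rw [mul_div_cancel_left₀ _ ha] at h
  exact h.congr_fun fun k => (ramanujanTheta_term ha b k).symm

lemma ramanujanTheta_eq {a b : ℂ} (ha : a ≠ 0) (hb : b ≠ 0) (hab : ‖a * b‖ < 1) :
    ramanujanTheta a b = qPochInf (-a) (a * b) * qPochInf (-b) (a * b) * eulerE (a * b) :=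
  (hasSum_ramanujanTheta ha hb hab).tsum_eq

lemma ramanujanTheta_zero : ramanujanTheta 0 0 = 1 := by
  rw [ramanujanTheta, tsum_eq_single 0]
  · simp
  · intro k hk
    have h : k * (k + 1) / 2 ≠ 0 ∨ k * (k - 1) / 2 ≠ 0 := by
      have e1 : k * (k + 1) = k * (k - 1) + k * 2 := by ring
      rw [e1, Int.add_mul_ediv_right _ _ two_ne_zero]
      omega
    rcases h with h | h <;> simp [zero_zpow _ h]

lemma thetaPsi_mul {q : ℂ} (hq : ‖q‖ < 1) : thetaPsi q * eulerE q = eulerE (q ^ 2) ^ 2 := by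
  rcases eq_or_ne q 0 with rfl | h0
  · simp [thetaPsi, ramanujanTheta_zero, eulerE_zero]
  have hq2 := norm_pow_lt_one hq two_ne_zero
  have h4 : q * q ^ 3 = q ^ 4 := by ring
  rw [thetaPsi, ramanujanTheta_eq h0 (pow_ne_zero 3 h0) (by
    rw [h4]; exact norm_pow_lt_one hq four_ne_zero), h4]
  have h1 := qPochInf_split_two (-q) hq2
  have h2 := qPochInf_neg_odd hq
  rw [← pow_mul, show -q * q ^ 2 = -q ^ 3 by ring] at h1
  rw [h1] at h2
  linear_combination h2

lemma thetaPsi_neg_mul {q : ℂ} (hq : ‖q‖ < 1) :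
    thetaPsi (-q) * eulerE (q ^ 2) = eulerE q * eulerE (q ^ 4) := by
  have h1 := thetaPsi_mul (q := -q) (by rwa [norm_neg])
  have h2 := eulerE_neg hq
  rw [neg_sq] at h1
  have hne := eulerE_pow_ne_zero hq two_ne_zero
  apply mul_right_cancel₀ (pow_ne_zero 2 hne)
  linear_combination -thetaPsi (-q) * h2 + eulerE q * eulerE (q ^ 4) * h1

/-- `φ(-q) = (q; q)_∞² / (q²; q²)_∞`. -/
lemma thetaPhi_neg_mul {q : ℂ} (hq : ‖q‖ < 1) :
    thetaPhi (-q) * eulerE (q ^ 2) = eulerE q ^ 2 := by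
  rcases eq_or_ne q 0 with rfl | h0
  · simp [thetaPhi, ramanujanTheta_zero, eulerE_zero]
  have h2 : -q * -q = q ^ 2 := by ring
  rw [thetaPhi, ramanujanTheta_eq (neg_ne_zero.2 h0) (neg_ne_zero.2 h0) (by
    rw [h2]; exact norm_pow_lt_one hq two_ne_zero), h2, neg_neg, ← qPochInf_odd hq]
  ring

lemma thetaChi_neg_mul {q : ℂ} (hq : ‖q‖ < 1) :
    thetaChi (-q) * eulerE (q ^ 2) = eulerE q := by
  rw [thetaChi, neg_neg, neg_sq, qPochInf_odd hq]

/-- `f(q, q²)`, whose exponents are the pentagonal numbers. -/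
noncomputable def thetaPent (q : ℂ) : ℂ := ramanujanTheta q (q ^ 2)

/-- `(q, q²; q³)_∞ = (q; q)_∞ / (q³; q³)_∞`. -/
lemma qPochInf_not_three {q : ℂ} (hq : ‖q‖ < 1) :
    qPochInf q (q ^ 3) * qPochInf (q ^ 2) (q ^ 3) * eulerE (q ^ 3) = eulerE q := by
  rw [eulerE, eulerE, qPochInf_split_three q hq]
  ring_nf

lemma thetaPent_mul {q : ℂ} (hq : ‖q‖ < 1) :
    thetaPent q * (eulerE q * eulerE (q ^ 6)) = eulerE (q ^ 2) * eulerE (q ^ 3) ^ 2 := by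
  rcases eq_or_ne q 0 with rfl | h0
  · simp [thetaPent, ramanujanTheta_zero, eulerE_zero]
  have hq2 := norm_pow_lt_one hq two_ne_zero
  have hq3 := norm_pow_lt_one hq three_ne_zero
  have h3 : q * q ^ 2 = q ^ 3 := by ring
  rw [thetaPent, ramanujanTheta_eq h0 (pow_ne_zero 2 h0) (by rwa [h3]), h3]
  have h1 := qPochInf_mul_neg q hq3
  have h2 := qPochInf_mul_neg (q ^ 2) hq3
  have h4 := qPochInf_not_three hq
  have h5 := qPochInf_not_three hq2
  simp only [← pow_mul] at h1 h2 h5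
  norm_num at h1 h2 h5
  rw [← h4, ← h5, ← h1, ← h2]
  ring

lemma thetaPent_neg_mul {q : ℂ} (hq : ‖q‖ < 1) :
    thetaPent (-q) * (eulerE (q ^ 2) ^ 2 * eulerE (q ^ 3) ^ 2 * eulerE (q ^ 12) ^ 2) =
      eulerE q * eulerE (q ^ 4) * eulerE (q ^ 6) ^ 5 := by
  have h1 := thetaPent_mul (q := -q) (by rwa [norm_neg])
  have h2 := eulerE_neg hq
  have h3 := eulerE_neg (norm_pow_lt_one hq three_ne_zero)
  rw [neg_sq, show (-q) ^ 6 = q ^ 6 by ring, show (-q) ^ 3 = -q ^ 3 by ring] at h1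
  rw [← pow_mul, ← pow_mul] at h3
  norm_num at h3
  have n2 := eulerE_pow_ne_zero hq two_ne_zero
  have n6 := eulerE_pow_ne_zero hq (k := 6) (by norm_num)
  apply mul_right_cancel₀ (mul_ne_zero n2 n6)
  linear_combination -thetaPent (-q) * eulerE (q ^ 6) * (eulerE (q ^ 3) * eulerE (q ^ 12)) ^ 2 * h2
    + eulerE q * eulerE (q ^ 4) * (eulerE (q ^ 3) * eulerE (q ^ 12)) ^ 2 * h1
    + eulerE (q ^ 2) * eulerE q * eulerE (q ^ 4) *
      (eulerE (-q ^ 3) * (eulerE (q ^ 3) * eulerE (q ^ 12)) + eulerE (q ^ 6) ^ 3) * h3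

/-! ### The three-term relation for theta functions of degree two -/

/-- The theta function `∑ (-1)^k q^{k(k-1)/2} z^k = (z; q)_∞ (q/z; q)_∞ (q; q)_∞`. -/
noncomputable def modTheta (q z : ℂ) : ℂ := ∑' k : ℤ, q ^ (k * (k - 1) / 2) * (-z) ^ k

/-- `∑ q^{s²} y^{2s}`, the even basis element for products of two theta functions. -/
noncomputable def thetaEven (q y : ℂ) : ℂ := ∑' s : ℤ, q ^ (s ^ 2) * y ^ (2 * s)

/-- `∑ q^{s²+s} y^{2s+1}`, the odd basis element for products of two theta functions. -/
noncomputable def thetaOdd (q y : ℂ) : ℂ := ∑' s : ℤ, q ^ (s ^ 2 + s) * y ^ (2 * s + 1)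

lemma modTheta_eq {q : ℂ} (hq : ‖q‖ < 1) (hq0 : q ≠ 0) {z z' : ℂ} (hz : z ≠ 0) (hzz : z * z' = q) :
    modTheta q z = qPochInf z q * qPochInf z' q * eulerE q := by
  have h := (hasSum_tripleProduct hq hq0 (neg_ne_zero.2 hz)).tsum_eq
  have h1 : -(q / -z) = z' := by rw [← hzz]; field_simp
  rwa [neg_neg, h1] at h

/-- Quasi-periodicity of the theta function. -/
lemma modTheta_mul_base {q : ℂ} (hq0 : q ≠ 0) {z : ℂ} (hz : z ≠ 0) : modTheta q z = -z * modTheta q (q * z) := by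
  have hz' := neg_ne_zero.2 hz
  rw [modTheta, modTheta, ← tsum_mul_left, ← (Equiv.addRight (1 : ℤ)).tsum_eq]
  refine tsum_congr fun k => ?_
  simp only [Equiv.coe_addRight]
  rw [add_sub_cancel_right, zpow_choose_succ hq0, zpow_add_one₀ hz', ← mul_neg, mul_zpow]
  ring

lemma summable_thetaEven {q : ℂ} (hq : ‖q‖ < 1) (hq0 : q ≠ 0) {y : ℂ} (hy : y ≠ 0) :
    Summable fun s : ℤ => ‖q ^ (s ^ 2) * y ^ (2 * s)‖ := by
  refine (summable_norm_theta (norm_pow_lt_one hq two_ne_zero) (pow_ne_zero 2 hq0)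
    (mul_ne_zero hq0 (pow_ne_zero 2 hy))).congr fun s => ?_
  congr 1
  rw [mul_zpow, ← zpow_natCast q, ← zpow_natCast y, ← zpow_mul, ← zpow_mul, ← mul_assoc,
    ← zpow_add₀ hq0]
  congr 2
  have := Int.two_mul_ediv_two_of_even (Int.even_mul_pred_self s)
  push_cast
  linarith

lemma summable_thetaOdd {q : ℂ} (hq : ‖q‖ < 1) (hq0 : q ≠ 0) {y : ℂ} (hy : y ≠ 0) :
    Summable fun s : ℤ => ‖q ^ (s ^ 2 + s) * y ^ (2 * s + 1)‖ := by
  refine ((summable_norm_theta (norm_pow_lt_one hq two_ne_zero) (pow_ne_zero 2 hq0)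
    (mul_ne_zero (pow_ne_zero 2 hq0) (pow_ne_zero 2 hy))).mul_right ‖y‖).congr fun s => ?_
  rw [← norm_mul]
  congr 1
  rw [mul_zpow, ← zpow_natCast q, ← zpow_natCast y, ← zpow_mul, ← zpow_mul, ← zpow_mul,
    ← mul_assoc, ← zpow_add₀ hq0, mul_assoc, ← zpow_add_one₀ hy]
  congr 2
  have := Int.two_mul_ediv_two_of_even (Int.even_mul_pred_self s)
  push_cast
  linarith

lemma modTheta_term_mul {q x y : ℂ} (hq0 : q ≠ 0) (hx : x ≠ 0) (hy : y ≠ 0) (j k m n e : ℤ)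
    (hm : j + k = m)
    (hn : j - k = n) (he : j * (j - 1) + k * (k - 1) = 2 * e) :
    q ^ (j * (j - 1) / 2) * (x * y) ^ j * (q ^ (k * (k - 1) / 2) * (x / y) ^ k) =
      q ^ e * x ^ m * y ^ n := by
  have h1 := Int.two_mul_ediv_two_of_even (Int.even_mul_pred_self j)
  have h2 := Int.two_mul_ediv_two_of_even (Int.even_mul_pred_self k)
  rw [show e = j * (j - 1) / 2 + k * (k - 1) / 2 by linarith, ← hm, ← hn, mul_zpow, div_zpow,
    zpow_add₀ hq0, zpow_add₀ hx, zpow_sub₀ hy]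
  ring

lemma hasSum_mul_of_summable_norm {f g : ℤ → ℂ} (hf : Summable fun k => ‖f k‖)
    (hg : Summable fun k => ‖g k‖) :
    HasSum (fun p : ℤ × ℤ => f p.1 * g p.2) ((∑' k, f k) * ∑' k, g k) := by
  rw [tsum_mul_tsum_of_summable_norm hf hg]
  exact (summable_mul_of_summable_norm hf hg).hasSum

/-- A product of two theta functions, written in terms of the even and odd basis elements:
the lattice of the double sum is split by the parity of the sum of its coordinates. -/
lemma modTheta_mul_modTheta {q : ℂ} (hq : ‖q‖ < 1) (hq0 : q ≠ 0) {x y : ℂ} (hx : x ≠ 0) (hy : y ≠ 0) :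
    modTheta q (x * y) * modTheta q (x / y) =
      x * (thetaOdd q x * thetaEven q y - thetaEven q x * thetaOdd q y) := by
  have hx' := neg_ne_zero.2 hx
  have s1 := summable_norm_theta hq hq0 (mul_ne_zero hx' hy)
  have s2 := summable_norm_theta hq hq0 (div_ne_zero hx' hy)
  have h := hasSum_mul_of_summable_norm s1 s2
  have h0 : HasSum _ (x * (thetaOdd q x * thetaEven q y)) := (hasSum_mul_of_summable_norm
    (summable_thetaOdd hq hq0 hx) (summable_thetaEven hq hq0 hy)).mul_left x
  have h1 : HasSum _ (-x * (thetaEven q x * thetaOdd q y)) := (hasSum_mul_of_summable_norm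
    (summable_thetaEven hq hq0 hx) (summable_thetaOdd hq hq0 hy)).mul_left (-x)
  -- index pairs with even sum are parametrised by `f0`, those with odd sum by `f1`
  let f0 : ℤ × ℤ → ℤ × ℤ := fun p => (p.1 + p.2 + 1, p.1 - p.2 + 1)
  let f1 : ℤ × ℤ → ℤ × ℤ := fun p => (p.1 + p.2 + 1, p.1 - p.2)
  have i0 : Function.Injective f0 := fun a b hab => by
    simp only [f0, Prod.mk.injEq] at hab
    ext <;> omega
  have i1 : Function.Injective f1 := fun a b hab => by
    simp only [f1, Prod.mk.injEq] at hab
    ext <;> omega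
  have hc : IsCompl (Set.range f0) (Set.range f1) := by
    refine ⟨Set.disjoint_left.2 ?_, codisjoint_iff.2 (Set.eq_univ_of_forall fun ⟨j, k⟩ => ?_)⟩
    · rintro _ ⟨a, rfl⟩ ⟨b, hb⟩
      simp only [f0, f1, Prod.mk.injEq] at hb
      omega
    · rcases Int.even_or_odd' (j + k) with ⟨m, hm | hm⟩
      · exact Or.inl ⟨(m - 1, j - m), by simp only [f0, Prod.mk.injEq]; omega⟩
      · exact Or.inr ⟨(m, j - 1 - m), by simp only [f1, Prod.mk.injEq]; omega⟩
  have hneg : ∀ n : ℤ, (-x) ^ (2 * n) = x ^ (2 * n) := fun n => by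
    rw [zpow_mul, zpow_mul]; norm_num
  set f : ℤ × ℤ → ℂ := fun p =>
    q ^ (p.1 * (p.1 - 1) / 2) * (-x * y) ^ p.1 * (q ^ (p.2 * (p.2 - 1) / 2) * (-x / y) ^ p.2)
    with hf
  have g0 : HasSum (f ∘ f0) (x * (thetaOdd q x * thetaEven q y)) := h0.congr_fun fun p => by
    rw [Function.comp, hf]
    dsimp only
    rw [modTheta_term_mul hq0 hx' hy _ _ (2 * (p.1 + 1)) (2 * p.2)
      (p.1 ^ 2 + p.1 + p.2 ^ 2) (by simp only [f0]; ring) (by simp only [f0]; ring)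
      (by simp only [f0]; ring), hneg, zpow_add₀ hq0,
      show 2 * (p.1 + 1) = 2 * p.1 + 1 + 1 by ring, zpow_add_one₀ hx (2 * p.1 + 1)]
    ring
  have g1 : HasSum (f ∘ f1) (-x * (thetaEven q x * thetaOdd q y)) := h1.congr_fun fun p => by
    rw [Function.comp, hf]
    dsimp only
    rw [modTheta_term_mul hq0 hx' hy _ _ (2 * p.1 + 1) (2 * p.2 + 1)
      (p.1 ^ 2 + (p.2 ^ 2 + p.2)) (by simp only [f1]; ring) (by simp only [f1]; ring)
      (by simp only [f1]; ring), zpow_add_one₀ hx', hneg, zpow_add₀ hq0]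
    ring
  have h2 := h.unique ((i0.hasSum_range_iff.2 g0).add_isCompl hc (i1.hasSum_range_iff.2 g1))
  rw [modTheta, modTheta, ← neg_mul, ← neg_div, h2]
  ring

/-- An instance of Weierstrass' three-term relation, in base `q⁶`. -/
lemma modTheta_three_term {q : ℂ} (hq : ‖q‖ < 1) (hq0 : q ≠ 0) :
    modTheta (q ^ 6) (q ^ 2) * modTheta (q ^ 6) (q ^ 4) * modTheta (q ^ 6) (-q ^ 2) ^ 2 -
      q * (modTheta (q ^ 6) q * modTheta (q ^ 6) (q ^ 5) *
        (modTheta (q ^ 6) (-q) * modTheta (q ^ 6) (-q ^ 5))) =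
      modTheta (q ^ 6) (-q ^ 3) ^ 2 * (modTheta (q ^ 6) q * modTheta (q ^ 6) (q ^ 3)) := by
  have h6 := norm_pow_lt_one hq (k := 6) (by norm_num)
  have h60 := pow_ne_zero 6 hq0
  have P := fun {x y : ℂ} (hx : x ≠ 0) (hy : y ≠ 0) => modTheta_mul_modTheta h6 h60 hx hy
  -- the Plücker relation is applied at `x = q³`, `y = q⁻¹`, `u = q²`, `v = -1`
  have hx := pow_ne_zero 3 hq0
  have hy := inv_ne_zero hq0
  have hu := pow_ne_zero 2 hq0
  have hv : (-1 : ℂ) ≠ 0 := by norm_num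
  have pxy := P hx hy
  have puv := P hu hv
  have pxu := P hx hu
  have pvy := P hv hy
  have pxv := P hx hv
  have puy := P hu hy
  have per := modTheta_mul_base h60 (z := -1 * q⁻¹) (mul_ne_zero hv hy)
  rw [show q ^ 6 * (-1 * q⁻¹) = -q ^ 5 by field_simp] at per
  rw [show q ^ 3 * q⁻¹ = q ^ 2 by field_simp, show q ^ 3 / q⁻¹ = q ^ 4 by field_simp] at pxy
  rw [show q ^ 2 * -1 = -q ^ 2 by ring, show q ^ 2 / -1 = -q ^ 2 by ring] at puv
  rw [show q ^ 3 * q ^ 2 = q ^ 5 by ring, show q ^ 3 / q ^ 2 = q by field_simp] at pxu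
  rw [per, show -1 / q⁻¹ = -q by field_simp] at pvy
  rw [show q ^ 3 * -1 = -q ^ 3 by ring, show q ^ 3 / -1 = -q ^ 3 by ring] at pxv
  rw [show q ^ 2 * q⁻¹ = q by field_simp, show q ^ 2 / q⁻¹ = q ^ 3 by field_simp] at puy
  have pvy' : modTheta (q ^ 6) (-q) * modTheta (q ^ 6) (-q ^ 5) = -q * (
      thetaOdd (q ^ 6) (-1) * thetaEven (q ^ 6) q⁻¹ -
        thetaEven (q ^ 6) (-1) * thetaOdd (q ^ 6) q⁻¹) := by
    have hqi := mul_inv_cancel₀ hq0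
    linear_combination q * pvy -
      modTheta (q ^ 6) (-q) * modTheta (q ^ 6) (-q ^ 5) * hqi
  rw [pow_two (modTheta (q ^ 6) (-q ^ 2)), pow_two (modTheta (q ^ 6) (-q ^ 3)), pxy, puv, pvy',
    pxv, puy, mul_comm (modTheta (q ^ 6) q), pxu]
  ring

/-! ### The level-12 identities -/

section

variable {q : ℂ} (hq : ‖q‖ < 1) (hq0 : q ≠ 0)
include hq hq0

lemma modTheta_two : modTheta (q ^ 6) (q ^ 2) = eulerE (q ^ 2) := by
  have h6 := norm_pow_lt_one hq (k := 6) (by norm_num)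
  have h := qPochInf_not_three (norm_pow_lt_one hq two_ne_zero)
  simp only [← pow_mul] at h
  rw [modTheta_eq h6 (pow_ne_zero 6 hq0) (pow_ne_zero 2 hq0) (z' := q ^ 4) (by ring), ← h]

lemma modTheta_four : modTheta (q ^ 6) (q ^ 4) = eulerE (q ^ 2) := by
  have h6 := norm_pow_lt_one hq (k := 6) (by norm_num)
  have h := qPochInf_not_three (norm_pow_lt_one hq two_ne_zero)
  simp only [← pow_mul] at h
  rw [modTheta_eq h6 (pow_ne_zero 6 hq0) (pow_ne_zero 4 hq0) (z' := q ^ 2) (by ring), ← h]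
  ring

lemma modTheta_neg_two : modTheta (q ^ 6) (-q ^ 2) * (eulerE (q ^ 2) * eulerE (q ^ 12)) =
    eulerE (q ^ 4) * eulerE (q ^ 6) ^ 2 := by
  have h6 := norm_pow_lt_one hq (k := 6) (by norm_num)
  have h := qPochInf_not_three (norm_pow_lt_one hq two_ne_zero)
  have h' := qPochInf_not_three (norm_pow_lt_one hq four_ne_zero)
  have h1 := qPochInf_mul_neg (q ^ 2) h6
  have h2 := qPochInf_mul_neg (q ^ 4) h6
  simp only [← pow_mul] at h h' h1 h2
  norm_num at h h' h1 h2
  rw [modTheta_eq h6 (pow_ne_zero 6 hq0) (neg_ne_zero.2 (pow_ne_zero 2 hq0)) (z' := -q ^ 4)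
    (by ring), ← h, ← h', ← h1, ← h2]
  ring

lemma modTheta_three : modTheta (q ^ 6) (q ^ 3) = qPochInf (q ^ 3) (q ^ 6) ^ 2 * eulerE (q ^ 6) := by
  have h6 := norm_pow_lt_one hq (k := 6) (by norm_num)
  rw [modTheta_eq h6 (pow_ne_zero 6 hq0) (pow_ne_zero 3 hq0) (z' := q ^ 3) (by ring), pow_two]

lemma modTheta_one : modTheta (q ^ 6) q * qPochInf (q ^ 3) (q ^ 6) =
    qPochInf q (q ^ 2) * eulerE (q ^ 6) := by
  have h6 := norm_pow_lt_one hq (k := 6) (by norm_num)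
  have h := qPochInf_split_three q (norm_pow_lt_one hq two_ne_zero)
  simp only [← pow_mul] at h
  norm_num at h
  rw [modTheta_eq h6 (pow_ne_zero 6 hq0) hq0 (z' := q ^ 5) (by ring), h]
  ring_nf

lemma modTheta_five : modTheta (q ^ 6) (q ^ 5) = modTheta (q ^ 6) q := by
  have h6 := norm_pow_lt_one hq (k := 6) (by norm_num)
  rw [modTheta_eq h6 (pow_ne_zero 6 hq0) hq0 (z' := q ^ 5) (by ring),
    modTheta_eq h6 (pow_ne_zero 6 hq0) (pow_ne_zero 5 hq0) (z' := q) (by ring)]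
  ring

end

/-- A 2-dissection of `f₁ / f₃³`, cleared of denominators. -/
lemma eulerE_level_twelve {q : ℂ} (hq : ‖q‖ < 1) :
    eulerE (q ^ 4) ^ 4 * eulerE (q ^ 6) ^ 2 * eulerE (q ^ 12) ^ 2 * eulerE (q ^ 2) *
        eulerE (q ^ 3) ^ 3 - q * eulerE (q ^ 2) ^ 3 * eulerE (q ^ 3) ^ 3 * eulerE (q ^ 12) ^ 6 =
      eulerE q * eulerE (q ^ 6) ^ 9 * eulerE (q ^ 4) ^ 2 := by
  rcases eq_or_ne q 0 with rfl | hq0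
  · simp [eulerE_zero]
  have h := modTheta_three_term hq hq0
  have hn : ‖-q‖ < 1 := by rwa [norm_neg]
  have hn0 := neg_ne_zero.2 hq0
  have hq3 := norm_pow_lt_one hq three_ne_zero
  have a1 := modTheta_one hq hq0
  have a2 := modTheta_neg_two hq hq0
  have b1 := modTheta_one hn hn0
  have b3 := modTheta_three hn hn0
  have b5 := modTheta_five hn hn0
  rw [show (-q) ^ 6 = q ^ 6 by ring, show (-q) ^ 3 = -q ^ 3 by ring] at b1 b3
  rw [show (-q) ^ 6 = q ^ 6 by ring, show (-q) ^ 5 = -q ^ 5 by ring] at b5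
  rw [neg_sq] at b1
  have o1 := qPochInf_odd hq
  have o3 := qPochInf_odd hq3
  have n1 := qPochInf_neg_odd hq
  have n3 := qPochInf_neg_odd hq3
  simp only [← pow_mul] at o3 n3
  norm_num at o3 n3
  have e1 := eulerE_ne_zero hq
  have e2 := eulerE_pow_ne_zero hq two_ne_zero
  have e3 := eulerE_pow_ne_zero hq three_ne_zero
  have e4 := eulerE_pow_ne_zero hq four_ne_zero
  have e6 := eulerE_pow_ne_zero hq (k := 6) (by norm_num)
  have e12 := eulerE_pow_ne_zero hq (k := 12) (by norm_num)
  rw [modTheta_two hq hq0, modTheta_four hq hq0, modTheta_three hq hq0, modTheta_five hq hq0, b3,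
    b5] at h
  rw [← eq_div_iff e2] at o1
  rw [← eq_div_iff e6] at o3
  rw [← eq_div_iff (mul_ne_zero e1 e4)] at n1
  rw [← eq_div_iff (mul_ne_zero e3 e12)] at n3
  rw [o1, o3, ← eq_div_iff (div_ne_zero e3 e6)] at a1
  rw [n1, n3, ← eq_div_iff (div_ne_zero (pow_ne_zero 2 e6) (mul_ne_zero e3 e12))] at b1
  rw [← eq_div_iff (mul_ne_zero e2 e12)] at a2
  rw [a1, a2, b1, o3, n3] at h
  generalize eulerE q = E1 at *
  generalize eulerE (q ^ 2) = E2 at *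
  generalize eulerE (q ^ 3) = E3 at *
  generalize eulerE (q ^ 4) = E4 at *
  generalize eulerE (q ^ 6) = E6 at *
  generalize eulerE (q ^ 12) = E12 at *
  clear a1 a2 b1 b3 b5 o1 o3 n1 n3
  field_simp at h
  linear_combination h

/-- A 2-dissection of `f₃³ / f₁`, cleared of denominators; it is `eulerE_level_twelve` at `-q`. -/
lemma eulerE_level_twelve_neg {q : ℂ} (hq : ‖q‖ < 1) :
    eulerE (q ^ 3) ^ 3 * eulerE (q ^ 2) ^ 2 * eulerE (q ^ 4) * eulerE (q ^ 12) =
      eulerE q * eulerE (q ^ 4) ^ 4 * eulerE (q ^ 6) ^ 2 +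
        q * eulerE q * eulerE (q ^ 2) ^ 2 * eulerE (q ^ 12) ^ 4 := by
  have h := eulerE_level_twelve (q := -q) (by rwa [norm_neg])
  have n1 := eulerE_neg hq
  have n3 := eulerE_neg (norm_pow_lt_one hq three_ne_zero)
  simp only [← pow_mul] at n3
  norm_num at n3
  have e1 := eulerE_ne_zero hq
  have e2 := eulerE_pow_ne_zero hq two_ne_zero
  have e3 := eulerE_pow_ne_zero hq three_ne_zero
  have e4 := eulerE_pow_ne_zero hq four_ne_zero
  have e6 := eulerE_pow_ne_zero hq (k := 6) (by norm_num)
  have e12 := eulerE_pow_ne_zero hq (k := 12) (by norm_num)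
  rw [← eq_div_iff (mul_ne_zero e1 e4)] at n1
  rw [← eq_div_iff (mul_ne_zero e3 e12)] at n3
  rw [show (-q) ^ 3 = -q ^ 3 by ring, show (-q) ^ 2 = q ^ 2 by ring,
    show (-q) ^ 4 = q ^ 4 by ring, show (-q) ^ 6 = q ^ 6 by ring,
    show (-q) ^ 12 = q ^ 12 by ring, n1, n3] at h
  generalize eulerE q = E1 at *
  generalize eulerE (q ^ 2) = E2 at *
  generalize eulerE (q ^ 3) = E3 at *
  generalize eulerE (q ^ 4) = E4 at *
  generalize eulerE (q ^ 6) = E6 at *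
  generalize eulerE (q ^ 12) = E12 at *
  clear n1 n3
  field_simp at h
  linear_combination -h

/-! ### The 3-dissections -/

lemma exists_primitive_cube_root : ∃ w : ℂ, w ^ 2 + w + 1 = 0 ∧ ‖w‖ = 1 := by
  obtain ⟨w, hw⟩ := IsAlgClosed.exists_eq_mul_self (-3 : ℂ)
  have h : ((-1 + w) / 2) ^ 2 + (-1 + w) / 2 + 1 = 0 := by linear_combination -hw / 4
  refine ⟨(-1 + w) / 2, h, ?_⟩
  have h3 : ((-1 + w) / 2) ^ 3 = 1 := by linear_combination ((-1 + w) / 2 - 1) * h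
  have : ‖(-1 + w) / 2‖ ^ 3 = 1 := by rw [← norm_pow, h3, norm_one]
  exact (pow_eq_one_iff_of_nonneg (norm_nonneg _) three_ne_zero).1 this

/-- The 3-dissection of `ψ`. -/
lemma thetaPsi_dissection {q : ℂ} (hq : ‖q‖ < 1) :
    thetaPsi q = thetaPent (q ^ 3) + q * thetaPsi (q ^ 9) := by
  rcases eq_or_ne q 0 with rfl | h0
  · simp [thetaPsi, thetaPent, ramanujanTheta_zero]
  have term : ∀ {q : ℂ}, q ≠ 0 → ∀ k : ℤ,
      q ^ (k * (k + 1) / 2) * (q ^ 3) ^ (k * (k - 1) / 2) = q ^ (2 * k ^ 2 - k) := fun {q} h0 k => by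
    rw [← zpow_natCast q 3, ← zpow_mul, ← zpow_add₀ h0]
    congr 1
    have h1 := Int.two_mul_ediv_two_of_even (Int.even_mul_succ_self k)
    have h2 := Int.two_mul_ediv_two_of_even (Int.even_mul_pred_self k)
    push_cast
    linarith
  have hpsi : ∀ {q : ℂ}, ‖q‖ < 1 → q ≠ 0 →
      HasSum (fun k : ℤ => q ^ (2 * k ^ 2 - k)) (thetaPsi q) := fun {q} hq h0 => by
    have h := hasSum_ramanujanTheta h0 (pow_ne_zero 3 h0) (by
      rw [show q * q ^ 3 = q ^ 4 by ring]; exact norm_pow_lt_one hq four_ne_zero)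
    exact (h.summable.hasSum : HasSum _ (thetaPsi q)).congr_fun fun k => (term h0 k).symm
  have hq3 := norm_pow_lt_one hq three_ne_zero
  have hpent : HasSum (fun k : ℤ => q ^ ((9 * k ^ 2 - 3 * k) / 2)) (thetaPent (q ^ 3)) := by
    have h := hasSum_ramanujanTheta (pow_ne_zero 3 h0) (pow_ne_zero 2 (pow_ne_zero 3 h0)) (by
      rw [show q ^ 3 * (q ^ 3) ^ 2 = (q ^ 3) ^ 3 by ring]; exact norm_pow_lt_one hq3 three_ne_zero)
    refine (h.summable.hasSum : HasSum _ (thetaPent (q ^ 3))).congr_fun fun k => ?_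
    rw [← pow_mul, ← zpow_natCast q, ← zpow_natCast q, ← zpow_mul, ← zpow_mul, ← zpow_add₀ h0]
    congr 1
    have h1 := Int.two_mul_ediv_two_of_even (Int.even_mul_succ_self k)
    have h2 := Int.two_mul_ediv_two_of_even (Int.even_mul_pred_self k)
    refine Int.ediv_eq_of_eq_mul_right two_ne_zero ?_
    push_cast
    linarith
  have hpsi9 := ((hpsi (norm_pow_lt_one hq (k := 9) (by norm_num))
    (pow_ne_zero 9 h0)).mul_left q)
  -- `f0` runs through the indices that are `0` or `2` modulo 3 and `f1` through the remaining ones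
  let f0 : ℤ → ℤ := fun k => if Even k then 3 * (k / 2) else 3 * (-(k / 2)) - 1
  let f1 : ℤ → ℤ := fun k => 3 * (-k) + 1
  have i0 : Function.Injective f0 := fun a b hab => by
    simp only [f0] at hab
    split_ifs at hab with ha hb hb <;> grind
  have i1 : Function.Injective f1 := fun a b hab => by
    simp only [f1] at hab
    omega
  have hc : IsCompl (Set.range f0) (Set.range f1) := by
    refine ⟨Set.disjoint_left.2 ?_, codisjoint_iff.2 (Set.eq_univ_of_forall fun k => ?_)⟩
    · rintro _ ⟨a, rfl⟩ ⟨b, hb⟩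
      simp only [f0, f1] at hb
      split_ifs at hb <;> omega
    · have h3 : k % 3 = 0 ∨ k % 3 = 1 ∨ k % 3 = 2 := by omega
      rcases h3 with h | h | h
      · exact Or.inl ⟨2 * (k / 3), by simp [f0]; omega⟩
      · exact Or.inr ⟨-(k / 3), by simp [f1]; omega⟩
      · refine Or.inl ⟨2 * (-(k / 3) - 1) + 1, ?_⟩
        have ho : ¬ Even (2 * (-(k / 3) - 1) + 1) := by
          rw [Int.not_even_iff_odd]; exact ⟨_, rfl⟩
        simp only [f0, if_neg ho]
        omega
  set f : ℤ → ℂ := fun k => q ^ (2 * k ^ 2 - k) with hf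
  have g0 : HasSum (f ∘ f0) (thetaPent (q ^ 3)) := hpent.congr_fun fun k => by
    simp only [Function.comp, hf, f0]
    congr 1
    symm
    refine Int.ediv_eq_of_eq_mul_right two_ne_zero ?_
    rcases Int.even_or_odd' k with ⟨m, hm | hm⟩
    · have he : Even k := ⟨m, by omega⟩
      have hd : k / 2 = m := by omega
      rw [if_pos he, hd, hm]
      ring
    · have he : ¬ Even k := by rw [Int.not_even_iff_odd]; exact ⟨m, hm⟩
      have hd : k / 2 = m := by omega
      rw [if_neg he, hd, hm]
      ring
  have g1 : HasSum (f ∘ f1) (q * thetaPsi (q ^ 9)) := hpsi9.congr_fun fun k => by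
    simp only [Function.comp, hf, f1]
    rw [← zpow_natCast q 9, ← zpow_mul, ← zpow_one_add₀ h0]
    congr 1
    push_cast
    ring
  exact (hpsi hq h0).unique ((i0.hasSum_range_iff.2 g0).add_isCompl hc (i1.hasSum_range_iff.2 g1))

lemma thetaPsi_ne_zero {q : ℂ} (hq : ‖q‖ < 1) : thetaPsi q ≠ 0 := fun h => by
  have := thetaPsi_mul hq
  rw [h, zero_mul] at this
  exact pow_ne_zero 2 (eulerE_pow_ne_zero hq two_ne_zero) this.symm

/-- The cubes of the two components of `ψ` combine to an eta quotient: take the product of the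
3-dissection of `ψ` over the three cube roots of `q`. -/
lemma thetaPent_cube_add {q : ℂ} (hq : ‖q‖ < 1) :
    (thetaPent q ^ 3 + q * thetaPsi (q ^ 3) ^ 3) * thetaPsi (q ^ 3) = thetaPsi q ^ 4 := by
  obtain ⟨w, hw, hw1⟩ := exists_primitive_cube_root
  obtain ⟨t, rfl⟩ := IsAlgClosed.exists_pow_nat_eq q (n := 3) (by norm_num)
  have h3 : w ^ 3 = 1 := by linear_combination (w - 1) * hw
  have ht : ‖t‖ < 1 := by
    rw [norm_pow] at hq
    exact (pow_lt_one_iff_of_nonneg (norm_nonneg _) three_ne_zero).1 hq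
  have hwt : ‖w * t‖ < 1 := by rwa [norm_mul, hw1, one_mul]
  have hwwt : ‖w ^ 2 * t‖ < 1 := by rwa [norm_mul, norm_pow, hw1, one_pow, one_mul]
  have e1 : (w * t) ^ 3 = t ^ 3 := by linear_combination t ^ 3 * h3
  have e2 : (w ^ 2 * t) ^ 3 = t ^ 3 := by linear_combination t ^ 3 * (w ^ 3 + 1) * h3
  have e3 : (w * t) ^ 9 = t ^ 9 := by
    rw [show (w * t) ^ 9 = ((w * t) ^ 3) ^ 3 by ring, e1]; ring
  have e4 : (w ^ 2 * t) ^ 9 = t ^ 9 := by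
    rw [show (w ^ 2 * t) ^ 9 = ((w ^ 2 * t) ^ 3) ^ 3 by ring, e2]; ring
  have e5 : (w ^ 2 * t) ^ 2 = w * t ^ 2 := by linear_combination w * t ^ 2 * h3
  have d0 := thetaPsi_dissection ht
  have d1 := thetaPsi_dissection hwt
  have d2 := thetaPsi_dissection hwwt
  rw [e1, e3] at d1
  rw [e2, e4] at d2
  have m0 := thetaPsi_mul ht
  have m1 := thetaPsi_mul hwt
  have m2 := thetaPsi_mul hwwt
  have m3 := thetaPsi_mul hq
  have m9 := thetaPsi_mul (norm_pow_lt_one ht (k := 9) (by norm_num))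
  rw [e5] at m2
  rw [mul_pow] at m1
  have c := eulerE_mul_cube hw ht
  have c2 := eulerE_mul_cube hw (norm_pow_lt_one ht two_ne_zero)
  simp only [← pow_mul] at c2 m3 m9 ⊢
  norm_num at c2 m3 m9 ⊢
  have hprod : thetaPent (t ^ 3) ^ 3 + t ^ 3 * thetaPsi (t ^ 9) ^ 3 =
      thetaPsi t * thetaPsi (w * t) * thetaPsi (w ^ 2 * t) := by
    rw [d0, d1, d2]
    linear_combination (-(thetaPent (t ^ 3) ^ 2 * (t * thetaPsi (t ^ 9))) -
      thetaPent (t ^ 3) * (t * thetaPsi (t ^ 9)) ^ 2 * w) * hw -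
      (t * thetaPsi (t ^ 9)) ^ 3 * h3
  rw [hprod]
  have n1 := eulerE_ne_zero ht
  have n2 := eulerE_ne_zero hwt
  have n3 := eulerE_ne_zero hwwt
  have n4 := eulerE_ne_zero hq
  have n9 := eulerE_pow_ne_zero ht (k := 9) (by norm_num)
  have n18 := eulerE_pow_ne_zero ht (k := 18) (by norm_num)
  have n6 := eulerE_pow_ne_zero ht (k := 6) (by norm_num)
  rw [← eq_div_iff n1] at m0
  rw [← eq_div_iff n2] at m1
  rw [← eq_div_iff n3] at m2
  rw [← eq_div_iff n4] at m3
  rw [← eq_div_iff n9] at m9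
  rw [m0, m1, m2, m3, m9, div_mul_div_comm, div_mul_div_comm, div_mul_div_comm, div_pow, ← c,
    show eulerE (t ^ 2) ^ 2 * eulerE (w ^ 2 * t ^ 2) ^ 2 * eulerE (w * t ^ 2) ^ 2 *
      eulerE (t ^ 18) ^ 2 = (eulerE (t ^ 6) ^ 4) ^ 2 by rw [← c2]; ring]
  ring

/-- The reciprocal of `ψ(q)`, rationalised by the sum of two cubes. -/
lemma inv_thetaPsi {q : ℂ} (hq : ‖q‖ < 1) :
    (thetaPsi q)⁻¹ = (thetaPent (q ^ 3) ^ 2 - q * thetaPent (q ^ 3) * thetaPsi (q ^ 9) +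
      q ^ 2 * thetaPsi (q ^ 9) ^ 2) * (thetaPsi (q ^ 9) / thetaPsi (q ^ 3) ^ 4) := by
  have h := thetaPent_cube_add (norm_pow_lt_one hq three_ne_zero)
  simp only [← pow_mul] at h
  norm_num at h
  have d := thetaPsi_dissection hq
  have n3 := thetaPsi_ne_zero (norm_pow_lt_one hq three_ne_zero)
  refine inv_eq_of_mul_eq_one_right ?_
  rw [← mul_assoc, ← mul_div_assoc, div_eq_one_iff_eq (pow_ne_zero 4 n3), ← h, d]
  ring

/-! ### The components of the dissection as eta quotients -/

section

variable {q : ℂ} (hq : ‖q‖ < 1)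
include hq

lemma thetaPsi_eq_div : thetaPsi q = eulerE (q ^ 2) ^ 2 / eulerE q :=
  (eq_div_iff (eulerE_ne_zero hq)).2 (thetaPsi_mul hq)

lemma thetaPsi_neg_eq_div : thetaPsi (-q) = eulerE q * eulerE (q ^ 4) / eulerE (q ^ 2) :=
  (eq_div_iff (eulerE_pow_ne_zero hq two_ne_zero)).2 (thetaPsi_neg_mul hq)

lemma thetaPhi_neg_eq_div : thetaPhi (-q) = eulerE q ^ 2 / eulerE (q ^ 2) :=
  (eq_div_iff (eulerE_pow_ne_zero hq two_ne_zero)).2 (thetaPhi_neg_mul hq)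

lemma thetaChi_neg_eq_div : thetaChi (-q) = eulerE q / eulerE (q ^ 2) :=
  (eq_div_iff (eulerE_pow_ne_zero hq two_ne_zero)).2 (thetaChi_neg_mul hq)

lemma thetaPent_eq_div :
    thetaPent q = eulerE (q ^ 2) * eulerE (q ^ 3) ^ 2 / (eulerE q * eulerE (q ^ 6)) :=
  (eq_div_iff (mul_ne_zero (eulerE_ne_zero hq) (eulerE_pow_ne_zero hq (by norm_num)))).2
    (thetaPent_mul hq)

lemma thetaPent_neg_eq_div : thetaPent (-q) = eulerE q * eulerE (q ^ 4) * eulerE (q ^ 6) ^ 5 /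
    (eulerE (q ^ 2) ^ 2 * eulerE (q ^ 3) ^ 2 * eulerE (q ^ 12) ^ 2) := by
  refine (eq_div_iff (mul_ne_zero (mul_ne_zero ?_ ?_) ?_)).2 (thetaPent_neg_mul hq) <;>
  exact pow_ne_zero 2 (eulerE_pow_ne_zero hq (by norm_num))

lemma thetaPsi_pow_eq_div (k : ℕ) (hk : k ≠ 0) :
    thetaPsi (q ^ k) = eulerE (q ^ (k * 2)) ^ 2 / eulerE (q ^ k) := by
  rw [thetaPsi_eq_div (norm_pow_lt_one hq hk), ← pow_mul]

lemma thetaPsi_neg_pow_eq_div (k : ℕ) (hk : k ≠ 0) : thetaPsi (-q ^ k) =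
    eulerE (q ^ k) * eulerE (q ^ (k * 4)) / eulerE (q ^ (k * 2)) := by
  rw [thetaPsi_neg_eq_div (norm_pow_lt_one hq hk), ← pow_mul, ← pow_mul]

lemma thetaPhi_neg_cube_eq_div :
    thetaPhi (-q ^ 3) = eulerE (q ^ 3) ^ 2 / eulerE (q ^ 6) := by
  rw [thetaPhi_neg_eq_div (norm_pow_lt_one hq three_ne_zero), ← pow_mul]

lemma thetaPent_sq_eq_div : thetaPent (q ^ 2) =
    eulerE (q ^ 4) * eulerE (q ^ 6) ^ 2 / (eulerE (q ^ 2) * eulerE (q ^ 12)) := by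
  rw [thetaPent_eq_div (norm_pow_lt_one hq two_ne_zero), ← pow_mul, ← pow_mul, ← pow_mul]

/-- The component identity behind `∑ A(3n+2) q^n`. -/
lemma dissection_two : (thetaPent (-q) * thetaPent (q ^ 2) +
    q * thetaPsi (-q ^ 3) * thetaPsi (q ^ 6)) * thetaPsi (q ^ 6) =
      thetaPsi (-q ^ 3) * thetaPsi (q ^ 2) ^ 2 := by
  have h := eulerE_level_twelve hq
  have e1 := eulerE_ne_zero hq
  have e2 := eulerE_pow_ne_zero hq two_ne_zero
  have e3 := eulerE_pow_ne_zero hq three_ne_zero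
  have e4 := eulerE_pow_ne_zero hq four_ne_zero
  have e6 := eulerE_pow_ne_zero hq (k := 6) (by norm_num)
  have e12 := eulerE_pow_ne_zero hq (k := 12) (by norm_num)
  rw [thetaPent_neg_eq_div hq, thetaPent_sq_eq_div hq, thetaPsi_neg_pow_eq_div hq 3 (by norm_num),
    thetaPsi_pow_eq_div hq 6 (by norm_num), thetaPsi_pow_eq_div hq 2 (by norm_num)]
  norm_num
  generalize eulerE q = E1 at *
  generalize eulerE (q ^ 2) = E2 at *
  generalize eulerE (q ^ 3) = E3 at *
  generalize eulerE (q ^ 4) = E4 at *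
  generalize eulerE (q ^ 6) = E6 at *
  generalize eulerE (q ^ 12) = E12 at *
  field_simp
  linear_combination -h

/-- The component identity behind `∑ A(3n+1) q^n`. -/
lemma dissection_one : (thetaPsi (-q ^ 3) * thetaPent (q ^ 2) ^ 2 -
    q * thetaPent (-q) * thetaPsi (q ^ 6) ^ 2) * thetaPsi (q ^ 6) * thetaPsi (-q) =
      thetaPsi (q ^ 3) ^ 2 * thetaChi (-q) ^ 2 * thetaPsi (q ^ 2) ^ 3 := by
  have h := eulerE_level_twelve_neg hq
  have e1 := eulerE_ne_zero hq
  have e2 := eulerE_pow_ne_zero hq two_ne_zero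
  have e3 := eulerE_pow_ne_zero hq three_ne_zero
  have e4 := eulerE_pow_ne_zero hq four_ne_zero
  have e6 := eulerE_pow_ne_zero hq (k := 6) (by norm_num)
  have e12 := eulerE_pow_ne_zero hq (k := 12) (by norm_num)
  rw [thetaPent_neg_eq_div hq, thetaPent_sq_eq_div hq, thetaPsi_neg_pow_eq_div hq 3 (by norm_num),
    thetaPsi_pow_eq_div hq 6 (by norm_num), thetaPsi_pow_eq_div hq 2 (by norm_num),
    thetaPsi_neg_eq_div hq, thetaPsi_pow_eq_div hq 3 (by norm_num), thetaChi_neg_eq_div hq]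
  norm_num
  generalize eulerE q = E1 at *
  generalize eulerE (q ^ 2) = E2 at *
  generalize eulerE (q ^ 3) = E3 at *
  generalize eulerE (q ^ 4) = E4 at *
  generalize eulerE (q ^ 6) = E6 at *
  generalize eulerE (q ^ 12) = E12 at *
  field_simp
  linear_combination h

/-- The component identity behind `∑ A(3n) q^n`. -/
lemma dissection_zero : thetaPent (q ^ 2) * thetaPsi (-q ^ 3) * thetaPsi (-q) =
    thetaChi (-q) * thetaPsi (q ^ 3) * thetaPhi (-q ^ 3) * thetaPsi (q ^ 2) := by
  have e1 := eulerE_ne_zero hq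
  have e2 := eulerE_pow_ne_zero hq two_ne_zero
  have e3 := eulerE_pow_ne_zero hq three_ne_zero
  have e4 := eulerE_pow_ne_zero hq four_ne_zero
  have e6 := eulerE_pow_ne_zero hq (k := 6) (by norm_num)
  have e12 := eulerE_pow_ne_zero hq (k := 12) (by norm_num)
  rw [thetaPent_sq_eq_div hq, thetaPsi_neg_pow_eq_div hq 3 (by norm_num),
    thetaPsi_pow_eq_div hq 2 (by norm_num), thetaPhi_neg_cube_eq_div hq,
    thetaPsi_neg_eq_div hq, thetaPsi_pow_eq_div hq 3 (by norm_num), thetaChi_neg_eq_div hq]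
  norm_num
  field_simp

/-- The component of `∑ A(3n+2) q^n` whose coefficients are `A(9n+5)`, as an eta quotient. -/
lemma dissection_nine : thetaPsi (-q) * thetaPsi (q ^ 6) ^ 4 * thetaPent (q ^ 2) ^ 2 /
    thetaPsi (q ^ 2) ^ 7 =
      eulerF 1 q * eulerF 2 q ^ 4 * eulerF 12 q ^ 6 / eulerF 4 q ^ 11 := by
  have e1 := eulerE_ne_zero hq
  have e2 := eulerE_pow_ne_zero hq two_ne_zero
  have e4 := eulerE_pow_ne_zero hq four_ne_zero
  have e6 := eulerE_pow_ne_zero hq (k := 6) (by norm_num)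
  have e12 := eulerE_pow_ne_zero hq (k := 12) (by norm_num)
  simp only [eulerF_eq, pow_one]
  rw [thetaPent_sq_eq_div hq, thetaPsi_pow_eq_div hq 6 (by norm_num),
    thetaPsi_pow_eq_div hq 2 (by norm_num), thetaPsi_neg_eq_div hq]
  norm_num
  field_simp

end

/-- The generating function `f₁ / f₄` of `A(n)` equals `ψ(-q) / ψ(q²)`. -/
lemma eulerE_div_eulerE {q : ℂ} (hq : ‖q‖ < 1) :
    eulerE q / eulerE (q ^ 4) = thetaPsi (-q) * (thetaPsi (q ^ 2))⁻¹ := by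
  have e2 := eulerE_pow_ne_zero hq two_ne_zero
  have e4 := eulerE_pow_ne_zero hq four_ne_zero
  rw [thetaPsi_neg_eq_div hq, thetaPsi_pow_eq_div hq 2 (by norm_num)]
  norm_num
  field_simp

/-- The three components of the 3-dissection of `f₁ / f₄`. -/
noncomputable def cubicComponent : Fin 3 → ℂ → ℂ
  | 0 => fun q => thetaChi (-q) * thetaPsi (q ^ 3) * thetaPhi (-q ^ 3) /
          (thetaPsi (-q) * thetaPsi (q ^ 2))
  | 1 => fun q => -(thetaPsi (q ^ 3) ^ 2 * thetaChi (-q) ^ 2 / (thetaPsi (-q) * thetaPsi (q ^ 2)))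
  | 2 => fun q => -(thetaPsi (-q ^ 3) * thetaPsi (q ^ 6) / thetaPsi (q ^ 2) ^ 2)

lemma thetaPsi_neg_dissection {q : ℂ} (hq : ‖q‖ < 1) :
    thetaPsi (-q) = thetaPent (-q ^ 3) - q * thetaPsi (-q ^ 9) := by
  have h := thetaPsi_dissection (q := -q) (by rwa [norm_neg])
  rw [show (-q) ^ 3 = -q ^ 3 by ring, show (-q) ^ 9 = -q ^ 9 by ring] at h
  rw [h]
  ring

lemma eulerE_div_eulerE_dissection {q : ℂ} (hq : ‖q‖ < 1) :
    eulerE q / eulerE (q ^ 4) = cubicComponent 0 (q ^ 3) + q * cubicComponent 1 (q ^ 3) +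
      q ^ 2 * cubicComponent 2 (q ^ 3) := by
  have hq3 := norm_pow_lt_one hq three_ne_zero
  have i := inv_thetaPsi (norm_pow_lt_one hq two_ne_zero)
  have d0 := dissection_zero hq3
  have d1 := dissection_one hq3
  have d2 := dissection_two hq3
  have n1 := thetaPsi_ne_zero (q := -q ^ 3) (by rwa [norm_neg])
  have n2 := thetaPsi_ne_zero (norm_pow_lt_one hq3 two_ne_zero)
  rw [eulerE_div_eulerE hq, thetaPsi_neg_dissection hq, i]
  simp only [cubicComponent]
  simp only [← pow_mul] at d0 d1 d2 n2 ⊢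
  norm_num at d0 d1 d2 n2 ⊢
  generalize thetaPent (-q ^ 3) = a at *
  generalize thetaPsi (-q ^ 9) = p at *
  generalize thetaPent (q ^ 6) = B at *
  generalize thetaPsi (q ^ 18) = P at *
  generalize thetaPsi (q ^ 6) = s at *
  generalize thetaPsi (-q ^ 3) = r at *
  generalize thetaPsi (q ^ 9) = u at *
  generalize thetaChi (-q ^ 3) = c at *
  generalize thetaPhi (-q ^ 9) = f at *
  have f0 : c * u * f / (r * s) = B * p / s ^ 2 := by
    field_simp
    linear_combination -d0
  have f1 : u ^ 2 * c ^ 2 / (r * s) = (p * B ^ 2 - q ^ 3 * a * P ^ 2) * P / s ^ 4 := by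
    field_simp
    linear_combination -d1
  rw [f0, f1]
  field_simp
  linear_combination (B - q ^ 2 * P) * d2

/-! ### Analyticity of the components -/

lemma DifferentiableOn.comp_pow {F : ℂ → ℂ} (hF : DifferentiableOn ℂ F (Metric.ball 0 1)) {k : ℕ}
    (hk : k ≠ 0) : DifferentiableOn ℂ (fun q => F (q ^ k)) (Metric.ball 0 1) :=
  hF.comp (by fun_prop) fun q hq => by
    simpa using norm_pow_lt_one (by simpa using hq) hk

lemma DifferentiableOn.comp_neg {F : ℂ → ℂ} (hF : DifferentiableOn ℂ F (Metric.ball 0 1)) :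
    DifferentiableOn ℂ (fun q => F (-q)) (Metric.ball 0 1) :=
  hF.comp (by fun_prop) fun q hq => by simpa using hq

lemma differentiableOn_thetaPsi : DifferentiableOn ℂ thetaPsi (Metric.ball 0 1) :=
  (((differentiableOn_eulerE.comp_pow two_ne_zero).pow 2).div differentiableOn_eulerE
    fun q hq => eulerE_ne_zero (by simpa using hq)).congr
    fun q hq => thetaPsi_eq_div (by simpa using hq)

lemma differentiableOn_thetaPent : DifferentiableOn ℂ thetaPent (Metric.ball 0 1) :=
  (((differentiableOn_eulerE.comp_pow two_ne_zero).mul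
    ((differentiableOn_eulerE.comp_pow three_ne_zero).pow 2)).div
    (differentiableOn_eulerE.mul (differentiableOn_eulerE.comp_pow (k := 6) (by norm_num)))
    fun q hq => mul_ne_zero (eulerE_ne_zero (by simpa using hq))
      (eulerE_pow_ne_zero (by simpa using hq) (by norm_num))).congr
    fun q hq => thetaPent_eq_div (by simpa using hq)

lemma differentiableOn_thetaPhi_neg :
    DifferentiableOn ℂ (fun q => thetaPhi (-q)) (Metric.ball 0 1) :=
  ((differentiableOn_eulerE.pow 2).div (differentiableOn_eulerE.comp_pow two_ne_zero)
    fun q hq => eulerE_pow_ne_zero (by simpa using hq) two_ne_zero).congr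
    fun q hq => thetaPhi_neg_eq_div (by simpa using hq)

lemma differentiableOn_thetaChi_neg :
    DifferentiableOn ℂ (fun q => thetaChi (-q)) (Metric.ball 0 1) :=
  (differentiableOn_eulerE.div (differentiableOn_eulerE.comp_pow two_ne_zero)
    fun q hq => eulerE_pow_ne_zero (by simpa using hq) two_ne_zero).congr
    fun q hq => thetaChi_neg_eq_div (by simpa using hq)

lemma differentiableOn_cubicComponent (r : Fin 3) :
    DifferentiableOn ℂ (cubicComponent r) (Metric.ball 0 1) := by
  have p1 := differentiableOn_thetaPsi.comp_neg
  have p2 := differentiableOn_thetaPsi.comp_pow two_ne_zero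
  have p3 := differentiableOn_thetaPsi.comp_pow three_ne_zero
  have p6 := differentiableOn_thetaPsi.comp_pow (k := 6) (by norm_num)
  have p3' := p1.comp_pow three_ne_zero
  have f3 := differentiableOn_thetaPhi_neg.comp_pow three_ne_zero
  have c1 := differentiableOn_thetaChi_neg
  have n1 : ∀ q ∈ Metric.ball (0 : ℂ) 1, thetaPsi (-q) ≠ 0 := fun q hq =>
    thetaPsi_ne_zero (by simpa using hq)
  have n2 : ∀ q ∈ Metric.ball (0 : ℂ) 1, thetaPsi (q ^ 2) ≠ 0 := fun q hq =>
    thetaPsi_ne_zero (norm_pow_lt_one (by simpa using hq) two_ne_zero)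
  fin_cases r
  · exact ((c1.mul p3).mul f3).div (p1.mul p2) fun q hq => mul_ne_zero (n1 q hq) (n2 q hq)
  · exact (((p3.pow 2).mul (c1.pow 2)).div (p1.mul p2)
      fun q hq => mul_ne_zero (n1 q hq) (n2 q hq)).neg
  · exact ((p3'.mul p6).div (p2.pow 2) fun q hq => pow_ne_zero 2 (n2 q hq)).neg

/-- The three components of the 3-dissection of `∑ A(3n+2) q^n`, obtained by squaring the
rationalised reciprocal of `ψ(q²)`. -/
noncomputable def cubicSubcomponent (r : Fin 3) (q : ℂ) : ℂ :=
  -(thetaPsi (-q) * thetaPsi (q ^ 6) ^ 2 / thetaPsi (q ^ 2) ^ 7) *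
  ![thetaPent (q ^ 2) ^ 4 - 2 * q ^ 2 * thetaPent (q ^ 2) * thetaPsi (q ^ 6) ^ 3,
    3 * q * thetaPent (q ^ 2) ^ 2 * thetaPsi (q ^ 6) ^ 2,
    q ^ 2 * thetaPsi (q ^ 6) ^ 4 - 2 * thetaPent (q ^ 2) ^ 3 * thetaPsi (q ^ 6)] r

lemma differentiableOn_cubicSubcomponent (r : Fin 3) :
    DifferentiableOn ℂ (cubicSubcomponent r) (Metric.ball 0 1) := by
  have p1 := differentiableOn_thetaPsi.comp_neg
  have p2 := differentiableOn_thetaPsi.comp_pow two_ne_zero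
  have p6 := differentiableOn_thetaPsi.comp_pow (k := 6) (by norm_num)
  have b2 := differentiableOn_thetaPent.comp_pow two_ne_zero
  have hfac := ((p1.mul (p6.pow 2)).div (p2.pow 7) fun q hq => pow_ne_zero 7
    (thetaPsi_ne_zero (norm_pow_lt_one (by simpa using hq) two_ne_zero))).neg
  refine hfac.mul ?_
  fin_cases r <;> simp <;> fun_prop

lemma cubicComponent_two_dissection {q : ℂ} (hq : ‖q‖ < 1) :
    cubicComponent 2 q = cubicSubcomponent 0 (q ^ 3) + q * cubicSubcomponent 1 (q ^ 3) +
      q ^ 2 * cubicSubcomponent 2 (q ^ 3) := by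
  have hq3 := norm_pow_lt_one hq three_ne_zero
  have i := inv_thetaPsi (norm_pow_lt_one hq two_ne_zero)
  have n2 := thetaPsi_ne_zero (norm_pow_lt_one hq3 two_ne_zero)
  simp only [cubicComponent, cubicSubcomponent, Matrix.cons_val]
  rw [div_eq_mul_inv, ← inv_pow, i]
  simp only [← pow_mul] at n2 ⊢
  norm_num at n2 ⊢
  field_simp
  ring

/-! ### The generating function of `A(n)` -/

section

open PowerSeries PowerSeries.WithPiTopology

variable (R : Type*) [CommRing R]

/-- The generating function of partitions with weight `(-1)^{number of parts}`. -/
noncomputable def signedPartitionSeries : PowerSeries R :=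
  Nat.Partition.genFun fun _ j => (-1) ^ j

/-- The generating function of partitions into even parts, weighted by
`(-1)^{number of parts}`. -/
noncomputable def signedEvenPartitionSeries : PowerSeries R :=
  Nat.Partition.genFun fun i j => if Even i then (-1) ^ j else 0

variable [TopologicalSpace R]

lemma hasProd_one_sub_X_pow_mul (k : ℕ) (hk : k ≠ 0) :
    HasProd (fun n : ℕ => (1 - X ^ (k * (n + 1)) : PowerSeries R))
      ((pentagonalSeries R).expand k hk) := by
  have h := hasProd_one_sub_X_pow R
  rw [HasProd, tendsto_iff_coeff_tendsto] at h ⊢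
  intro d
  have e : ∀ s : Finset ℕ, ∏ n ∈ s, (1 - X ^ (k * (n + 1)) : PowerSeries R) =
      (∏ n ∈ s, (1 - X ^ (n + 1) : PowerSeries R)).expand k hk := fun s => by
    simp [map_prod, pow_mul]
  simp only [e, coeff_expand]
  split_ifs
  · exact h _
  · exact tendsto_const_nhds

variable [IsTopologicalRing R] [T2Space R]

/-- The Euler factor `1 / (1 + X^{i+1}) = (1 - X^{i+1}) / (1 - X^{2(i+1)})`. -/
lemma one_add_tsum_signed (i : ℕ) :
    (1 + ∑' j : ℕ, ((-1 : R) ^ (j + 1)) • (X : PowerSeries R) ^ ((i + 1) * (j + 1))) *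
      (1 - X ^ (2 * (i + 1))) = 1 - X ^ (i + 1) := by
  have h0 : constantCoeff (-X ^ (i + 1) : PowerSeries R) = 0 := by simp
  have h1 := tsum_pow_mul_one_sub_of_constantCoeff_eq_zero h0
  have e : ∀ j : ℕ, ((-1 : R) ^ (j + 1)) • (X : PowerSeries R) ^ ((i + 1) * (j + 1)) =
      (-X ^ (i + 1)) ^ (j + 1) := fun j => by
    rw [neg_pow (X ^ (i + 1) : PowerSeries R), pow_mul, smul_eq_C_mul]
    simp
  rw [(summable_pow_of_constantCoeff_eq_zero h0).tsum_eq_zero_add] at h1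
  simp only [e]
  rw [pow_zero] at h1
  rw [show (1 - X ^ (2 * (i + 1)) : PowerSeries R) = (1 - -X ^ (i + 1)) * (1 - X ^ (i + 1)) by ring,
    ← mul_assoc, h1, one_mul]

lemma signedPartitionSeries_mul :
    signedPartitionSeries R * (pentagonalSeries R).expand 2 two_ne_zero = pentagonalSeries R := by
  have h := (Nat.Partition.hasProd_genFun fun _ j => (-1 : R) ^ j).mul
    (hasProd_one_sub_X_pow_mul R 2 two_ne_zero)
  simp only [one_add_tsum_signed] at h
  exact h.unique (hasProd_one_sub_X_pow R)

lemma signedEvenPartitionSeries_mul :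
    signedEvenPartitionSeries R * (pentagonalSeries R).expand 4 four_ne_zero =
      (pentagonalSeries R).expand 2 two_ne_zero := by
  have h0 := Nat.Partition.hasProd_genFun fun i j => if Even i then (-1 : R) ^ j else 0
  have hinj : Function.Injective fun m : ℕ => 2 * m + 1 := fun a b h => by
    simp only at h; omega
  rw [← hinj.hasProd_iff] at h0
  · have h := h0.mul (hasProd_one_sub_X_pow_mul R 4 four_ne_zero)
    refine h.unique ((hasProd_one_sub_X_pow_mul R 2 two_ne_zero).congr_fun fun m => ?_)
    have he : Even (2 * m + 1 + 1) := ⟨m + 1, by ring⟩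
    have := one_add_tsum_signed R (2 * m + 1)
    rw [show 2 * (2 * m + 1 + 1) = 4 * (m + 1) by ring] at this
    simp only [Function.comp, if_pos he]
    rw [this]
    ring
  · intro i hi
    have ho : ¬ Even (i + 1) := fun he => hi ⟨i / 2, by
      obtain ⟨m, hm⟩ := he
      simp only
      omega⟩
    simp [ho]

end

lemma Multiset.prod_toFinsupp_neg_one_pow (m : Multiset ℕ) :
    (m.toFinsupp.prod fun _ j => (-1 : ℤ) ^ j) = (-1) ^ m.card := by
  rw [Finsupp.prod, Finset.prod_pow_eq_pow_sum, ← Multiset.toFinsupp_sum_eq]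
  rfl

lemma Multiset.prod_toFinsupp_even (m : Multiset ℕ) :
    (m.toFinsupp.prod fun i j => if Even i then (-1 : ℤ) ^ j else 0) =
      if ∀ i ∈ m, Even i then (-1) ^ m.card else 0 := by
  split_ifs with h
  · rw [← Multiset.prod_toFinsupp_neg_one_pow]
    exact Finset.prod_congr rfl fun i hi => if_pos (h i (by simpa using hi))
  · push Not at h
    obtain ⟨i, hi, hodd⟩ := h
    exact Finset.prod_eq_zero (i := i) (by simpa using hi) (if_neg hodd)

lemma cubicA_eq_sum (n : ℕ) [Fintype (CubicPartition n)] :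
    cubicA n = ∑ p : CubicPartition n, (-1) ^ p.numParts := by
  classical
  rw [cubicA, cubicEven, cubicOdd, Nat.card_eq_fintype_card, Nat.card_eq_fintype_card,
    Fintype.card_subtype, Fintype.card_subtype,
    ← Finset.sum_filter_add_sum_filter_not Finset.univ (fun p : CubicPartition n => Even p.numParts),
    Finset.sum_congr rfl (g := fun _ => (1 : ℤ)) fun p hp => (Finset.mem_filter.1 hp).2.neg_one_pow,
    Finset.sum_congr rfl (s₁ := Finset.univ.filter fun p : CubicPartition n => ¬ Even p.numParts)
      (g := fun _ => (-1 : ℤ)) fun p hp =>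
        (Nat.not_even_iff_odd.1 (Finset.mem_filter.1 hp).2).neg_one_pow]
  simp [sub_eq_add_neg]

/-- The two colours of a cubic partition, as a pair of ordinary partitions. -/
def CubicPartition.toPair {n : ℕ} (p : CubicPartition n) :
    Σ x : Finset.HasAntidiagonal.antidiagonal n, Nat.Partition x.1.1 × Nat.Partition x.1.2 :=
  ⟨⟨(p.red.sum, p.blue.sum), by simpa using p.sum_eq⟩,
    ⟨p.red, fun {i} hi => p.red_pos i hi, rfl⟩, ⟨p.blue, fun {i} hi => p.blue_pos i hi, rfl⟩⟩

lemma CubicPartition.toPair_injective (n : ℕ) :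
    Function.Injective (CubicPartition.toPair (n := n)) := fun _ _ h =>
  CubicPartition.ext (congrArg (fun x => x.2.1.parts) h) (congrArg (fun x => x.2.2.parts) h)

lemma CubicPartition.exists_toPair_eq {n i j : ℕ}
    (h : (i, j) ∈ Finset.HasAntidiagonal.antidiagonal n) (r : Nat.Partition i)
    (b : Nat.Partition j) (hb : ∀ k ∈ b.parts, Even k) :
    ∃ p : CubicPartition n, p.toPair = ⟨⟨(i, j), h⟩, (r, b)⟩ := by
  obtain ⟨r, hr, rfl⟩ := r
  obtain ⟨b, hb', rfl⟩ := b
  exact ⟨⟨r, b, fun _ hi => hr hi, fun _ hi => hb' hi, hb, by simpa using h⟩, rfl⟩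

lemma coeff_signed_mul_signedEven (n : ℕ) :
    PowerSeries.coeff n (signedPartitionSeries ℤ * signedEvenPartitionSeries ℤ) = cubicA n := by
  classical
  have := Fintype.ofFinite (CubicPartition n)
  rw [cubicA_eq_sum, PowerSeries.coeff_mul]
  simp only [signedPartitionSeries, signedEvenPartitionSeries, Nat.Partition.coeff_genFun,
    Multiset.prod_toFinsupp_neg_one_pow, Multiset.prod_toFinsupp_even, Finset.sum_mul_sum]
  symm
  rw [← Finset.sum_coe_sort (Finset.HasAntidiagonal.antidiagonal n)]
  simp only [← Fintype.sum_prod_type']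
  rw [← Fintype.sum_sigma' (fun (x : Finset.HasAntidiagonal.antidiagonal n)
    (y : Nat.Partition x.1.1 × Nat.Partition x.1.2) => (-1 : ℤ) ^ y.1.parts.card *
      if ∀ i ∈ y.2.parts, Even i then (-1) ^ y.2.parts.card else 0)]
  refine Fintype.sum_of_injective _ (CubicPartition.toPair_injective n) _ _ ?_ fun p => ?_
  · rintro ⟨⟨⟨i, j⟩, hij⟩, r, b⟩ hn
    dsimp only
    rw [if_neg, mul_zero]
    exact fun hb => hn (CubicPartition.exists_toPair_eq hij r b hb)
  · rw [CubicPartition.numParts, pow_add]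
    have hb : ∀ i ∈ p.toPair.2.2.parts, Even i := p.blue_even
    rw [if_pos hb]
    rfl

/-- The generating function of `A(n)`, in the form `(∑ A(n) X^n) f₄ = f₁`. -/
lemma mk_cubicA_mul : PowerSeries.mk cubicA *
    (PowerSeries.pentagonalSeries ℤ).expand 4 four_ne_zero = PowerSeries.pentagonalSeries ℤ := by
  have h : PowerSeries.mk cubicA = signedPartitionSeries ℤ * signedEvenPartitionSeries ℤ := by
    ext n
    rw [PowerSeries.coeff_mk, coeff_signed_mul_signedEven]
  rw [h, mul_assoc, signedEvenPartitionSeries_mul, signedPartitionSeries_mul]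

/-! ### Integral power series -/

open PowerSeries

/-- The integral power series `g` converges to `F` on the open unit disc. -/
def IntRepresents (g : PowerSeries ℤ) (F : ℂ → ℂ) : Prop :=
  Represents (g.map (Int.castRingHom ℂ)) F

namespace IntRepresents

variable {g h : PowerSeries ℤ} {F G : ℂ → ℂ}

lemma congr (hg : IntRepresents g F) (hFG : ∀ q : ℂ, ‖q‖ < 1 → F q = G q) : IntRepresents g G :=
  Represents.congr hg hFG

lemma unique (hg : IntRepresents g F) (hh : IntRepresents h F) : g = h :=
  map_injective _ (RingHom.injective_int _) (Represents.unique hg hh)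

lemma add (hg : IntRepresents g F) (hh : IntRepresents h G) :
    IntRepresents (g + h) fun q => F q + G q := by
  rw [IntRepresents, map_add]; exact Represents.add hg hh

lemma mul (hg : IntRepresents g F) (hh : IntRepresents h G) :
    IntRepresents (g * h) fun q => F q * G q := by
  rw [IntRepresents, map_mul]; exact Represents.mul hg hh

lemma neg (hg : IntRepresents g F) : IntRepresents (-g) fun q => -F q := fun q hq => by
  simpa using (hg q hq).neg

lemma X : IntRepresents X fun q => q := by
  have h := Represents.X_pow 1
  simp only [pow_one] at h
  rwa [IntRepresents, map_X]

lemma expand (hg : IntRepresents g F) (k : ℕ) (hk : k ≠ 0) :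
    IntRepresents (g.expand k hk) fun q => F (q ^ k) := by
  rw [IntRepresents, map_expand]; exact Represents.expand hg k hk

lemma comp_neg (hg : IntRepresents g F) :
    IntRepresents (rescale (-1) g) fun q => F (-q) := fun q hq => by
  refine (hg (-q) (by rwa [norm_neg])).congr_fun fun n => ?_
  rw [neg_pow q]
  simp only [coeff_map, coeff_rescale, map_mul, map_pow, map_neg, map_one]
  ring

lemma coeff_zero_eq (hg : IntRepresents g F) : ((coeff 0 g : ℤ) : ℂ) = F 0 := by
  have := hasSum_single (f := fun n : ℕ =>
    coeff n (g.map (Int.castRingHom ℂ)) * (0 : ℂ) ^ n) 0 fun n hn => by simp [hn]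
  simpa using this.unique (hg 0 (by simp))

/-- A formal quotient of power series represents the quotient of functions, provided that the
latter is analytic on the whole disc. -/
lemma of_mul_eq {u v : PowerSeries ℤ} {U V : ℂ → ℂ} (hu : IntRepresents u U)
    (hv : IntRepresents v V) (hF : DifferentiableOn ℂ F (Metric.ball 0 1))
    (hFU : ∀ q : ℂ, ‖q‖ < 1 → F q * U q = V q) (hU : U 0 ≠ 0) (hg : g * u = v) :
    IntRepresents g F := by
  obtain ⟨f, hf⟩ := Represents.exists_of_differentiableOn hF
  have hu0 : u.map (Int.castRingHom ℂ) ≠ 0 := fun h => by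
    have h1 := hu 0 (by simp)
    rw [h] at h1
    simp only [map_zero, zero_mul] at h1
    exact hU (h1.unique hasSum_zero)
  have h1 := ((hf.mul hu).congr hFU).unique hv
  rw [← hg, map_mul] at h1
  rw [IntRepresents, ← mul_right_cancel₀ hu0 h1]
  exact hf

end IntRepresents

/-- Euler's pentagonal number theorem, as a specialisation of the Jacobi triple product. -/
lemma intRepresents_eulerE : IntRepresents (pentagonalSeries ℤ) eulerE := fun q hq => by
  rcases eq_or_ne q 0 with rfl | h0
  · have := hasSum_single (f := fun n : ℕ =>
      coeff n ((pentagonalSeries ℤ).map (Int.castRingHom ℂ)) * (0 : ℂ) ^ n) 0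
      fun n hn => by simp [hn]
    have h1 := coeff_pentagonalSeries_pentagonal ℤ 0
    rw [show pentagonal 0 = 0 from rfl] at h1
    rw [coeff_map, h1] at this
    simpa [eulerE_zero] using this
  · have hq3 := norm_pow_lt_one hq three_ne_zero
    have h := hasSum_tripleProduct hq3 (pow_ne_zero 3 h0) (neg_ne_zero.2 h0)
    rw [neg_neg, show -(q ^ 3 / -q) = q ^ 2 by field_simp] at h
    have e := qPochInf_not_three hq
    rw [eulerE] at e
    rw [e] at h
    refine (pentagonal_injective.hasSum_iff fun n hn => ?_).1 (h.congr_fun fun k => ?_)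
    · rw [coeff_map, coeff_pentagonalSeries_eq_zero ℤ hn]
      simp
    · simp only [Function.comp, coeff_map, coeff_pentagonalSeries_pentagonal]
      have h2 := Int.two_mul_ediv_two_of_even (Int.even_mul_pred_self k)
      have h3 := two_mul_natCast_pentagonal k
      have h4 : ((Int.negOnePow k : ℤˣ) : ℤ) = ((-1 : ℤˣ) ^ k : ℤˣ) := rfl
      rw [neg_eq_neg_one_mul q, mul_zpow, ← zpow_natCast q 3, ← zpow_mul, mul_left_comm,
        ← zpow_add₀ h0, ← zpow_natCast q (pentagonal k)]
      congr 1
      · rcases Int.even_or_odd k with hk | hk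
        · simp [Int.negOnePow_even k hk, hk.neg_one_zpow]
        · simp [Int.negOnePow_odd k hk, hk.neg_one_zpow]
      · congr 1
        push_cast
        linarith

lemma exists_mul_pentagonalSeries : ∃ u : PowerSeries ℤ, pentagonalSeries ℤ * u = 1 := by
  refine (isUnit_iff_constantCoeff.2 ?_).exists_right_inv
  have h1 := coeff_pentagonalSeries_pentagonal ℤ 0
  rw [show pentagonal 0 = 0 from rfl] at h1
  rw [← coeff_zero_eq_constantCoeff_apply, h1]
  simp

lemma exists_intRepresents_thetaPsi : ∃ g, IntRepresents g thetaPsi := by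
  obtain ⟨u, hu⟩ := exists_mul_pentagonalSeries
  have e := intRepresents_eulerE
  have e2 := e.expand 2 two_ne_zero
  refine ⟨_, IntRepresents.of_mul_eq e (e2.mul e2) differentiableOn_thetaPsi (fun q hq => ?_)
    (eulerE_ne_zero (by simp)) (g := u * ((pentagonalSeries ℤ).expand 2 two_ne_zero *
      (pentagonalSeries ℤ).expand 2 two_ne_zero)) ?_⟩
  · rw [thetaPsi_mul hq, pow_two]
  · linear_combination ((pentagonalSeries ℤ).expand 2 two_ne_zero *
      (pentagonalSeries ℤ).expand 2 two_ne_zero) * hu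

lemma exists_intRepresents_thetaPent : ∃ g, IntRepresents g thetaPent := by
  obtain ⟨u, hu⟩ := exists_mul_pentagonalSeries
  have hu6 := congrArg (PowerSeries.expand 6 (by norm_num)) hu
  rw [map_mul, map_one] at hu6
  have e := intRepresents_eulerE
  have e2 := e.expand 2 two_ne_zero
  have e3 := e.expand 3 three_ne_zero
  have e6 := e.expand 6 (by norm_num)
  refine ⟨_, IntRepresents.of_mul_eq (e.mul e6) (e2.mul (e3.mul e3)) differentiableOn_thetaPent
    (fun q hq => ?_) (mul_ne_zero (eulerE_ne_zero (by simp)) (eulerE_ne_zero (by simp)))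
    (g := u * u.expand 6 (by norm_num) * ((pentagonalSeries ℤ).expand 2 two_ne_zero *
      ((pentagonalSeries ℤ).expand 3 three_ne_zero *
        (pentagonalSeries ℤ).expand 3 three_ne_zero))) ?_⟩
  · rw [thetaPent_mul hq, pow_two (eulerE (q ^ 3))]
  · linear_combination ((pentagonalSeries ℤ).expand 2 two_ne_zero *
      ((pentagonalSeries ℤ).expand 3 three_ne_zero *
        (pentagonalSeries ℤ).expand 3 three_ne_zero)) *
      (hu * ((pentagonalSeries ℤ).expand 6 (by norm_num) * u.expand 6 (by norm_num)) + hu6)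

lemma intRepresents_cubicA :
    IntRepresents (mk cubicA) fun q => eulerE q / eulerE (q ^ 4) := by
  have e := intRepresents_eulerE
  refine IntRepresents.of_mul_eq (e.expand 4 four_ne_zero) e (differentiableOn_eulerE.div
    (differentiableOn_eulerE.comp_pow four_ne_zero) fun q hq =>
      eulerE_pow_ne_zero (by simpa using hq) four_ne_zero) (fun q hq => ?_)
    (eulerE_ne_zero (by simp)) mk_cubicA_mul
  exact div_mul_cancel₀ _ (eulerE_pow_ne_zero hq four_ne_zero)

lemma hasSum_cubicA_trisection (r : Fin 3) {q : ℂ} (hq : ‖q‖ < 1) :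
    HasSum (fun n : ℕ => (cubicA (3 * n + (r : ℕ)) : ℂ) * q ^ n) (cubicComponent r q) := by
  simpa using Represents.trisection intRepresents_cubicA differentiableOn_cubicComponent
    (fun q hq => eulerE_div_eulerE_dissection hq) r hq

lemma intRepresents_cubicA_two :
    IntRepresents (mk fun n => cubicA (3 * n + 2)) (cubicComponent 2) := fun q hq => by
  simpa using hasSum_cubicA_trisection 2 hq

lemma hasSum_cubicA_nine {q : ℂ} (hq : ‖q‖ < 1) :
    HasSum (fun n : ℕ => (cubicA (9 * n + 5) : ℂ) * q ^ n)
      (-3 * q * (eulerF 1 q * eulerF 2 q ^ 4 * eulerF 12 q ^ 6 / eulerF 4 q ^ 11)) := by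
  have h := Represents.trisection intRepresents_cubicA_two differentiableOn_cubicSubcomponent
    (fun q hq => cubicComponent_two_dissection hq) 1 hq
  have e : cubicSubcomponent 1 q =
      -3 * q * (eulerF 1 q * eulerF 2 q ^ 4 * eulerF 12 q ^ 6 / eulerF 4 q ^ 11) := by
    rw [← dissection_nine hq]
    simp only [cubicSubcomponent, Matrix.cons_val]
    ring
  rw [← e]
  refine h.congr_fun fun n => ?_
  rw [coeff_map, coeff_mk]
  congr 3
  simp
  ring_nf

/-! ### The congruences modulo 3 -/

lemma expand_three_zmod (f : PowerSeries (ZMod 3)) : f.expand 3 three_ne_zero = f ^ 3 := by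
  have h := MvPowerSeries.map_frobenius_expand 3 three_ne_zero (f := f) (R := ZMod 3)
  rw [ZMod.frobenius_zmod, MvPowerSeries.map_id] at h
  exact h

/-- Modulo 3, the series `∑ A(3n+2) X^n` is `-ψ(-X³) ψ(X²)`. Its 3-dissection has the components
`g₀`, `0` and `g₂` with `g₂ = h₀(X³) - X (∑ A(3n+2) X^n)(X³)`. -/
lemma exists_dissection_mod_three : ∃ g₀ g₂ h₀ : PowerSeries (ZMod 3),
    let G : PowerSeries (ZMod 3) := mk fun n => (cubicA (3 * n + 2) : ZMod 3)
    G = g₀.expand 3 three_ne_zero + X ^ 1 * (0 : PowerSeries (ZMod 3)).expand 3 three_ne_zero +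
      X ^ 2 * g₂.expand 3 three_ne_zero ∧
    g₂ = h₀.expand 3 three_ne_zero + X ^ 1 * (-G).expand 3 three_ne_zero +
      X ^ 2 * (0 : PowerSeries (ZMod 3)).expand 3 three_ne_zero := by
  obtain ⟨p, hp⟩ := exists_intRepresents_thetaPsi
  obtain ⟨s, hs⟩ := exists_intRepresents_thetaPent
  -- the integral identities, read off from the identities of analytic functions
  have hG : (mk fun n => cubicA (3 * n + 2)) * (p.expand 2 two_ne_zero * p.expand 2 two_ne_zero) =
      -((rescale (-1) p).expand 3 three_ne_zero * p.expand 6 (by norm_num)) := by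
    refine (((intRepresents_cubicA_two.mul ((hp.expand 2 two_ne_zero).mul
      (hp.expand 2 two_ne_zero))).congr fun q hq => ?_).unique
      ((hp.comp_neg.expand 3 three_ne_zero).mul (hp.expand 6 (by norm_num))).neg)
    have n2 := thetaPsi_ne_zero (norm_pow_lt_one hq two_ne_zero)
    simp only [cubicComponent]
    field_simp
  have hd : p = s.expand 3 three_ne_zero + X * (p.expand 3 three_ne_zero).expand 3 three_ne_zero :=
    hp.unique (((hs.expand 3 three_ne_zero).add (IntRepresents.X.mul
      ((hp.expand 3 three_ne_zero).expand 3 three_ne_zero))).congr fun q hq => by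
        rw [thetaPsi_dissection hq, ← pow_mul])
  have hdn : rescale (-1) p = (rescale (-1) s).expand 3 three_ne_zero +
      -(X * ((rescale (-1) p).expand 3 three_ne_zero).expand 3 three_ne_zero) :=
    hp.comp_neg.unique (((hs.comp_neg.expand 3 three_ne_zero).add (IntRepresents.X.mul
      ((hp.comp_neg.expand 3 three_ne_zero).expand 3 three_ne_zero)).neg).congr fun q hq => by
        rw [thetaPsi_neg_dissection hq, ← pow_mul, sub_eq_add_neg])
  -- their reductions modulo 3
  have hGm := congrArg (PowerSeries.map (Int.castRingHom (ZMod 3))) hG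
  have hdm := congrArg (PowerSeries.map (Int.castRingHom (ZMod 3))) hd
  have hdnm := congrArg (PowerSeries.map (Int.castRingHom (ZMod 3))) hdn
  set N := PowerSeries.map (Int.castRingHom (ZMod 3)) (rescale (-1) p)
  set M := PowerSeries.map (Int.castRingHom (ZMod 3)) (rescale (-1) s)
  set P := PowerSeries.map (Int.castRingHom (ZMod 3)) p with hP
  set S := PowerSeries.map (Int.castRingHom (ZMod 3)) s
  set G : PowerSeries (ZMod 3) := mk fun n => (cubicA (3 * n + 2) : ZMod 3) with hGdef
  have hGmap : PowerSeries.map (Int.castRingHom (ZMod 3)) (mk fun n => cubicA (3 * n + 2)) = G := by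
    ext n; simp [hGdef]
  have hP2 : P.expand 2 two_ne_zero ≠ 0 := fun h => by
    have h0 := hp.coeff_zero_eq
    rw [thetaPsi, show (0 : ℂ) ^ 3 = 0 by norm_num, ramanujanTheta_zero] at h0
    have h1 := congrArg (coeff 0) h
    rw [coeff_expand, if_pos (dvd_zero 2), Nat.zero_div, map_zero, hP, coeff_map,
      show coeff 0 p = 1 by exact_mod_cast h0, map_one] at h1
    exact one_ne_zero h1
  have h6 : P.expand 6 (by norm_num) = (P.expand 2 two_ne_zero) ^ 3 := by
    rw [← expand_three_zmod, ← expand_mul 3 three_ne_zero 2 two_ne_zero]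
  have h6' : P.expand 6 (by norm_num) = (P.expand 3 three_ne_zero).expand 2 two_ne_zero := by
    rw [← expand_mul 2 two_ne_zero 3 three_ne_zero]
  simp only [map_mul, map_add, map_neg, map_expand, map_X, hGmap] at hGm hdm hdnm
  rw [h6] at hGm
  have hGfin : G = -(N.expand 3 three_ne_zero * P.expand 2 two_ne_zero) := by
    apply mul_right_cancel₀ (mul_ne_zero hP2 hP2)
    rw [hGm]
    ring
  have hcomm : ∀ f : PowerSeries (ZMod 3), (f.expand 3 three_ne_zero).expand 2 two_ne_zero =
      (f.expand 2 two_ne_zero).expand 3 three_ne_zero := fun f => by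
    rw [← expand_mul, ← expand_mul]
  refine ⟨-(N * S.expand 2 two_ne_zero),
    -(N * (P.expand 3 three_ne_zero).expand 2 two_ne_zero), -(M * P.expand 2 two_ne_zero), ?_, ?_⟩
  · have hdm2 := congrArg (PowerSeries.expand 2 two_ne_zero) hdm
    simp only [map_mul, map_add, expand_X, hcomm] at hdm2
    rw [hGfin, hdm2]
    simp only [map_mul, map_neg, map_zero, hcomm]
    ring
  · rw [hGfin]
    nth_rewrite 1 [hdnm]
    simp only [map_mul, map_neg, map_zero, hcomm]
    ring

theorem theorem1p4 :
    (∀ q : ℂ, ‖q‖ < 1 →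
      -- the denominators below do not vanish
      (thetaPsi (-q) ≠ 0 ∧ thetaPsi (q ^ 2) ≠ 0 ∧ eulerF 4 q ≠ 0) ∧
      HasSum (fun n : ℕ => (cubicA (3 * n) : ℂ) * q ^ n)
        (thetaChi (-q) * thetaPsi (q ^ 3) * thetaPhi (-q ^ 3) /
          (thetaPsi (-q) * thetaPsi (q ^ 2))) ∧
      HasSum (fun n : ℕ => (cubicA (3 * n + 1) : ℂ) * q ^ n)
        (-(thetaPsi (q ^ 3) ^ 2 * thetaChi (-q) ^ 2 /
          (thetaPsi (-q) * thetaPsi (q ^ 2)))) ∧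
      HasSum (fun n : ℕ => (cubicA (3 * n + 2) : ℂ) * q ^ n)
        (-(thetaPsi (-q ^ 3) * thetaPsi (q ^ 6) / thetaPsi (q ^ 2) ^ 2)) ∧
      HasSum (fun n : ℕ => (cubicA (9 * n + 5) : ℂ) * q ^ n)
        (-3 * q * (eulerF 1 q * eulerF 2 q ^ 4 * eulerF 12 q ^ 6 / eulerF 4 q ^ 11))) ∧
    (∀ n : ℕ, cubicA (3 * n + 2) ≡ -cubicA (27 * n + 17) [ZMOD 3]) ∧
    (∀ n : ℕ, cubicA (81 * n + 44) ≡ 0 [ZMOD 3]) := by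
  have hmod : ∀ n : ℕ, (cubicA (9 * n + 5) : ZMod 3) = 0 ∧
      (cubicA (27 * n + 17) : ZMod 3) = -(cubicA (3 * n + 2) : ZMod 3) := fun n => by
    obtain ⟨g₀, g₂, h₀, h1, h2⟩ := exists_dissection_mod_three
    set G : PowerSeries (ZMod 3) := mk fun n => (cubicA (3 * n + 2) : ZMod 3) with hG
    have c1 := coeff_trisection ![g₀, 0, g₂] 1 n
    have c2 := coeff_trisection ![g₀, 0, g₂] 2 (3 * n + 1)
    have c3 := coeff_trisection ![h₀, -G, 0] 1 n
    simp only [Matrix.cons_val, ← h1, ← h2] at c1 c2 c3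
    constructor
    · simpa [hG, show 3 * (3 * n + 1) + 2 = 9 * n + 5 by ring] using c1
    · have c4 := c2.trans c3
      simpa [hG, show 3 * (3 * (3 * n + 1) + 2) + 2 = 27 * n + 17 by ring] using c4
  refine ⟨fun q hq => ⟨⟨thetaPsi_ne_zero (by rwa [norm_neg]),
    thetaPsi_ne_zero (norm_pow_lt_one hq two_ne_zero), eulerE_pow_ne_zero hq four_ne_zero⟩,
    hasSum_cubicA_trisection 0 hq, hasSum_cubicA_trisection 1 hq, hasSum_cubicA_trisection 2 hq,
    hasSum_cubicA_nine hq⟩, fun n => ?_, fun n => ?_⟩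
  · refine (ZMod.intCast_eq_intCast_iff _ _ 3).1 ?_
    push_cast
    rw [(hmod n).2, neg_neg]
  · refine (ZMod.intCast_eq_intCast_iff _ _ 3).1 ?_
    have h1 := (hmod (3 * n + 1)).2
    rw [show 27 * (3 * n + 1) + 17 = 81 * n + 44 by ring,
      show 3 * (3 * n + 1) + 2 = 9 * n + 5 by ring, (hmod n).1] at h1
    simpa using h1
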